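/- **Setting.** Let $\Omega\subset\mathbb R^2$ be a polygonal domain (bounded, open, connected, equal to the interior of its closure, with boundary contained in finitely many segments), and let $T,D_c,D_\theta,\lambda,\theta_*>0$, $0<\theta_-<\theta_+$. Let $\kappa\in W^{1,\infty}((0,1)\times(0,\infty))$, taken as a continuous function on $[0,1]\times(0,\infty)$, with $\kappa\ge\kappa_{\inf}>0$; let $s,s_c,s_\theta\in L^2(\Omega)$; let $\mathbf f(t)\in L^2(\Omega)^2$ for $t\in[0,T]$ with $t\mapsto\|\mathbf f(t)\|_{L^2}$ continuous; let $c_0,\theta_0\in H^1(\Omega)$ and assume, a.e. in $\Omega$, $$0\le c_0\le 1,\quad \theta_-\le\theta_0\le\theta_+,\quad 0\le s_c\le 2s+\lambda,\quad 2(\theta_--\theta_*)s+s_\theta\le 0\le 2(\theta_+-\theta_*)s+s_\theta .$$ **Mesh.** $\mathcal T_h$ is a conforming triangular mesh of $\overline\Omega$ all of whose angles are $<\pi/2$. For $K\in\mathcal T_h$ let $\mathbf x_K$ be the circumcenter, $h_K$ the diameter of the circumscribed circle, $h=\max_K h_K$. For an edge $\sigma$ of $K$ let $\mathbf x_\sigma$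 be its middle, $|\sigma|$ its length, $\mathbf n_{K,\sigma}$ the unit normal pointing outward of $K$. An interior edge is shared by two triangles $K_\sigma,L_\sigma$ (for an interior edge of $K$ we write $L_\sigma$ for the other triangle), and $d_\sigma=|\mathbf x_{K_\sigma}-\mathbf x_{L_\sigma}|$; for a boundary edge $d_\sigma=|\mathbf x_{K_\sigma}-\mathbf x_\sigma|$. Put $\tau_\sigma=|\sigma|/d_\sigma$. Fix $\rho>0$; the mesh is $\rho$-regular if $d_\sigma\ge\rho|\sigma|$ and $|\sigma|\ge\rho h$ for all edges $\sigma$. **Spaces and operators.** $P_0$ is the space of functions that are constant on each triangle, $\mathbf P_0=(P_0)^2$; $P_1^{nc}$ the space of functions affine on each triangle and continuous at the middles of interior edges; $\nabla_h$ is the gradient taken triangle by triangle; $L^2_0$ is the space of functions in $L^2(\Omega)$ of zero mean; $\mathbf{RT_0}$ is the space of vector fields affine on each triangle whose normal component is constant on each edge, agrees on both sides of interior edges, and vanishes on $\partial\Omega$. $\Pi_{P_0}$, $\widetilde\Pi_{P_1^{nc}}$, $\widetilde\Pi_{\mathbf{RT_0}}$ are the $L^2$-orthogonal projections. With $a^+=\max(a,0)$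 and $a^-=\min(a,0)$, and sums over the interior edges $\sigma$ of $K$, $$\Delta_hq|_K=\frac1{|K|}\sum_\sigma\tau_\sigma(q_{L_\sigma}-q_K),\qquad \widetilde b_h(\mathbf v,q)|_K=\frac1{|K|}\sum_\sigma|\sigma|\big((\mathbf v\cdot\mathbf n_{K,\sigma})^+q_K+(\mathbf v\cdot\mathbf n_{K,\sigma})^-q_{L_\sigma}\big),$$ and for $\mathbf v\in\mathbf P_0$, $\mathrm{div}_h\mathbf v\in P_1^{nc}$ is given by $(\mathrm{div}_h\mathbf v)(\mathbf x_\sigma)=\frac{3|\sigma|}{|K_\sigma|+|L_\sigma|}(\mathbf v_{L_\sigma}-\mathbf v_{K_\sigma})\cdot\mathbf n_{K_\sigma,\sigma}$ on interior edges and $-\frac{3|\sigma|}{|K_\sigma|}\mathbf v_{K_\sigma}\cdot\mathbf n_{K_\sigma,\sigma}$ on boundary edges. **Scheme.** Let $N\ge1$, $k=T/N$, $t_m=mk$, let $s_h,s_h^c,s_h^\theta$ be the $\Pi_{P_0}$-projections of $s,s_c,s_\theta$, and let $\mathbf f_h^m$ be the (componentwise) $\Pi_{P_0}$-projection of $\mathbf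 f(t_m)$. A discrete solution consists of $c_h^m,\theta_h^m\in P_0$, $p_h^m\in P_1^{nc}\cap L^2_0$, $\mathbf u_h^m\in\mathbf{RT_0}$, $0\le m\le N$, with $c_h^0=\Pi_{P_0}c_0$, $\theta_h^0=\Pi_{P_0}\theta_0$, for $0\le n<N$ $$\frac{c_h^{n+1}-c_h^n}{k}-D_c\Delta_hc_h^{n+1}=s_h^c-(s_h+\lambda)c_h^{n+1}-\widetilde b_h(\mathbf u_h^n,c_h^{n+1}),$$ $$\frac{\theta_h^{n+1}-\theta_h^n}{k}-D_\theta\Delta_h\theta_h^{n+1}=-s_h^\theta-s_h(\theta_h^{n+1}-\theta_*)-\widetilde b_h(\mathbf u_h^n,\theta_h^{n+1}),$$ and for $0\le m\le N$, with $\kappa_h^m=\kappa(c_h^m,\theta_h^m)$, $$\mathrm{div}_h(\kappa_h^m\nabla_hp_h^m)=\mathrm{div}_h\mathbf f_h^m-\widetilde\Pi_{P_1^{nc}}s_h,\qquad \mathbf u_h^m=\widetilde\Pi_{\mathbf{RT_0}}(\mathbf f_h^m-\kappa_h^m\nabla_hp_h^m).$$ With $\varepsilon=\max(h,k)$, let $c_\varepsilon(t)=c_h^{n+1}$,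 $\theta_\varepsilon(t)=\theta_h^{n+1}$ for $t\in(t_n,t_{n+1}]\cap(0,T)$, $0\le n<N$, and $c_\varepsilon(t)=\theta_\varepsilon(t)=0$ for $t\notin(0,T)$. For $w:\mathbb R\to P_0$ integrable let $\widehat w(\tau)=\int_{\mathbb R}e^{-2i\pi\tau t}w(t)\,dt$, and let $|\cdot|$ denote the norm of $L^2(\Omega)$ when applied to functions on $\Omega$. **Proposition.** Let $0<\gamma<\frac14$. There is a constant $C$, depending only on the data above, on $\rho$ and on $\gamma$, such that for every $\rho$-regular mesh, every $N\ge1$ (hence for all $\varepsilon>0$ that occur) and every discrete solution, $$\int_{\mathbb R}|\tau|^{2\gamma}\big(|\widehat c_\varepsilon(\tau)|^2+|\widehat\theta_\varepsilon(\tau)|^2\big)\,d\tau\le C .$$ -/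

import Mathlib

open MeasureTheory Set
open scoped FourierTransform ContDiff ENNReal NNReal

noncomputable section

namespace NuclearTransport

/-- The Euclidean plane. -/
abbrev Plane : Type := EuclideanSpace ℝ (Fin 2)

/-! ### Sobolev spaces on an open set of the plane -/

/-- `g` is the weak partial derivative of `f` in the `i`-th coordinate direction on the open set
`U`: both are locally integrable on `U` and integration by parts holds against all smooth test
functions with compact support in `U`. -/
def HasWeakPartial (U : Set Plane) (i : Fin 2) (f g : Plane → ℝ) : Prop :=
  LocallyIntegrableOn f U ∧ LocallyIntegrableOn g U ∧
    ∀ φ : Plane → ℝ, ContDiff ℝ ∞ φ → HasCompactSupport φ → tsupport φ ⊆ U →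
      ∫ x in U, f x * fderiv ℝ φ x (EuclideanSpace.single i 1) = - ∫ x in U, g x * φ x

/-- `f ∈ W^{1,q}(U)`: `f` and its first weak partial derivatives lie in `L^q(U)`. -/
def MemW1 (U : Set Plane) (q : ℝ≥0∞) (f : Plane → ℝ) : Prop :=
  MemLp f q (volume.restrict U) ∧
    ∀ i : Fin 2, ∃ g : Plane → ℝ, MemLp g q (volume.restrict U) ∧ HasWeakPartial U i f g

/-! ### The data of the contamination problem -/

/-- `Ω` is a polygonal domain: bounded, open, connected, lying locally on one side of its boundary
(no slits), with a boundary contained in finitely many line segments. -/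
structure IsPolygonalDomain (Ω : Set Plane) : Prop where
  isOpen : IsOpen Ω
  isConnected : IsConnected Ω
  isBounded : Bornology.IsBounded Ω
  interior_closure : interior (closure Ω) = Ω
  frontier_subset : ∃ E : Finset (Plane × Plane), frontier Ω ⊆ ⋃ e ∈ E, segment ℝ e.1 e.2

/-- The data: domain `Ω`, final time `T`, diffusion coefficients `Dc`, `Dθ`, decay rate `lam`,
reference temperature `θref`, bounds `θlo`, `θhi` of the initial temperature, the sources
`s`, `sc`, `sθ`, the initial values `c₀`, `θ₀`, the body force `f t x`, the mobility `κ c θ` and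
its lower bound `κinf`. -/
structure TransportData where
  Ω : Set Plane
  T : ℝ
  Dc : ℝ
  Dθ : ℝ
  lam : ℝ
  θref : ℝ
  θlo : ℝ
  θhi : ℝ
  s : Plane → ℝ
  sc : Plane → ℝ
  sθ : Plane → ℝ
  c₀ : Plane → ℝ
  θ₀ : Plane → ℝ
  f : ℝ → Plane → Plane
  κ : ℝ → ℝ → ℝ
  κinf : ℝ

/-- The standing assumptions on the data. -/
structure TransportData.Admissible (d : TransportData) : Prop where
  domain : IsPolygonalDomain d.Ω
  T_pos : 0 < d.T
  Dc_pos : 0 < d.Dc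
  Dθ_pos : 0 < d.Dθ
  lam_pos : 0 < d.lam
  θref_pos : 0 < d.θref
  θlo_pos : 0 < d.θlo
  θlo_lt_θhi : d.θlo < d.θhi
  /- `κ ∈ W^{1,∞}((0,1) × (0,∞))`, the function `κ` being the continuous representative on
  `[0,1] × (0,∞)`, bounded below by `κinf > 0`. -/
  κ_cont : ContinuousOn (fun z : ℝ × ℝ => d.κ z.1 z.2) (Icc 0 1 ×ˢ Ioi 0)
  κ_mem : MemW1 {x : Plane | x 0 ∈ Ioo (0 : ℝ) 1 ∧ x 1 ∈ Ioi (0 : ℝ)} ∞ (fun x => d.κ (x 0) (x 1))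
  κinf_pos : 0 < d.κinf
  κ_ge : ∀ a ∈ Icc (0 : ℝ) 1, ∀ b ∈ Ioi (0 : ℝ), d.κinf ≤ d.κ a b
  s_mem : MemLp d.s 2 (volume.restrict d.Ω)
  sc_mem : MemLp d.sc 2 (volume.restrict d.Ω)
  sθ_mem : MemLp d.sθ 2 (volume.restrict d.Ω)
  /- `f(t) ∈ L²(Ω)²` for all `t ∈ [0,T]`, with `t ↦ ‖f(t)‖` continuous on `[0,T]`. -/
  f_mem : ∀ t ∈ Icc 0 d.T, MemLp (d.f t) 2 (volume.restrict d.Ω)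
  f_cont : ContinuousOn (fun t => (eLpNorm (d.f t) 2 (volume.restrict d.Ω)).toReal) (Icc 0 d.T)
  c₀_mem : MemW1 d.Ω 2 d.c₀
  θ₀_mem : MemW1 d.Ω 2 d.θ₀
  c₀_bound : ∀ᵐ x ∂volume.restrict d.Ω, 0 ≤ d.c₀ x ∧ d.c₀ x ≤ 1
  θ₀_bound : ∀ᵐ x ∂volume.restrict d.Ω, d.θlo ≤ d.θ₀ x ∧ d.θ₀ x ≤ d.θhi
  sc_bound : ∀ᵐ x ∂volume.restrict d.Ω, 0 ≤ d.sc x ∧ d.sc x ≤ 2 * d.s x + d.lam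
  sθ_bound : ∀ᵐ x ∂volume.restrict d.Ω,
    2 * (d.θlo - d.θref) * d.s x + d.sθ x ≤ 0 ∧ 0 ≤ 2 * (d.θhi - d.θref) * d.s x + d.sθ x

/-! ### Triangles

The edges of a triangle `K` are indexed by the opposite vertex `i : Fin 3`. -/

/-- The edge of `K` opposite to the vertex `i`, as a closed segment. -/
def edge (K : Affine.Triangle ℝ Plane) (i : Fin 3) : Set Plane :=
  segment ℝ (K.points (i + 1)) (K.points (i + 2))

/-- The length `|σ|` of an edge. -/
def edgeLength (K : Affine.Triangle ℝ Plane) (i : Fin 3) : ℝ :=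
  dist (K.points (i + 1)) (K.points (i + 2))

/-- The middle `x_σ` of an edge. -/
def edgeMid (K : Affine.Triangle ℝ Plane) (i : Fin 3) : Plane :=
  midpoint ℝ (K.points (i + 1)) (K.points (i + 2))

/-- The unit normal `n_{K,σ}` to an edge, pointing outward of `K`: the normalized vector from the
opposite vertex to the foot of the altitude. -/
def outwardNormal (K : Affine.Triangle ℝ Plane) (i : Fin 3) : Plane :=
  ‖K.altitudeFoot i - K.points i‖⁻¹ • (K.altitudeFoot i - K.points i)

/-- The area `|K|`. -/
def area (K : Affine.Triangle ℝ Plane) : ℝ := volume.real K.closedInterior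

/-! ### Meshes -/

/-- A conforming triangular mesh of `Ω`, all of whose angles are less than `π / 2`. -/
structure TriMesh (Ω : Set Plane) where
  cells : Finset (Affine.Triangle ℝ Plane)
  cover : ⋃ K ∈ cells, K.closedInterior = closure Ω
  /-- A triangle is listed only once, whatever the order of its vertices. -/
  points_injOn : ∀ K ∈ cells, ∀ L ∈ cells, range K.points = range L.points → K = L
  /-- Two triangles meet along the convex hull of their common vertices. -/
  conforming : ∀ K ∈ cells, ∀ L ∈ cells,
    K.closedInterior ∩ L.closedInterior = convexHull ℝ (range K.points ∩ range L.points)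
  acute : ∀ K ∈ cells, K.AcuteAngled

namespace TriMesh

variable {Ω : Set Plane} (M : TriMesh Ω)

/-- The type of triangles of the mesh. -/
abbrev Cell : Type := {K : Affine.Triangle ℝ Plane // K ∈ M.cells}

/-- The space `P_0` of piecewise constant functions, given by the values `q_K`. -/
abbrev P0 : Type := M.Cell → ℝ

/-- The space of piecewise constant vector fields. -/
abbrev P0Vec : Type := M.Cell → Plane

/-- The space `P_1^d` of piecewise affine, possibly discontinuous, functions. -/
abbrev P1d : Type := M.Cell → (Plane →ᵃ[ℝ] ℝ)

/-- The space of piecewise affine, possibly discontinuous, vector fields. -/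
abbrev P1dVec : Type := M.Cell → (Plane →ᵃ[ℝ] Plane)

/-- The mesh size `h`: the largest diameter of a circumscribed circle. -/
def size : ℝ := ⨆ K : M.Cell, 2 * K.1.circumradius

open Classical in
/-- The triangles other than `K` having the `i`-th edge `σ` of `K` as an edge. For an interior edge
this is `{L_σ}`, for an edge on the boundary it is empty. -/
def nbrs (K : M.Cell) (i : Fin 3) : Finset M.Cell :=
  Finset.univ.filter fun L => L ≠ K ∧ ∃ j : Fin 3, edge L.1 j = edge K.1 i

/-- The regularity condition `d_σ ≥ ρ |σ|` and `|σ| ≥ ρ h` for all edges `σ`, where `d_σ` is the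
distance of the two circumcenters next to an interior edge, and the distance of the circumcenter to
the middle of the edge for a boundary edge. -/
def Regular (ρ : ℝ) : Prop :=
  ∀ (K : M.Cell) (i : Fin 3),
    (∀ L ∈ M.nbrs K i, ρ * edgeLength K.1 i ≤ dist K.1.circumcenter L.1.circumcenter) ∧
    (M.nbrs K i = ∅ → ρ * edgeLength K.1 i ≤ dist K.1.circumcenter (edgeMid K.1 i)) ∧
    ρ * M.size ≤ edgeLength K.1 i

variable {M}

/-- A piecewise constant function, given by its values, as a function on the plane. -/
def P0.toFun (q : M.P0) (x : Plane) : ℝ :=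
  ∑ K : M.Cell, indicator K.1.interior (fun _ => q K) x

/-- Membership in `P_1^{nc}`: continuity at the middles of the interior edges. -/
def IsP1nc (p : M.P1d) : Prop :=
  ∀ (K : M.Cell) (i : Fin 3), ∀ L ∈ M.nbrs K i, p K (edgeMid K.1 i) = p L (edgeMid K.1 i)

/-- Membership in `L²_0`: zero mean value. -/
def HasZeroMean (p : M.P1d) : Prop :=
  ∑ K : M.Cell, ∫ x in K.1.closedInterior, p K x = 0

/-- Membership in the Raviart-Thomas space `RT_0`: normal components are constant on every edge,
agree on both sides of interior edges, and vanish on the boundary. -/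
structure IsRT0 (v : M.P1dVec) : Prop where
  const : ∀ (K : M.Cell) (i : Fin 3), ∀ x ∈ edge K.1 i, ∀ y ∈ edge K.1 i,
    inner ℝ (v K x) (outwardNormal K.1 i) = inner ℝ (v K y) (outwardNormal K.1 i)
  interior : ∀ (K : M.Cell) (i : Fin 3), ∀ L ∈ M.nbrs K i, ∀ x ∈ edge K.1 i,
    inner ℝ (v K x) (outwardNormal K.1 i) = inner ℝ (v L x) (outwardNormal K.1 i)
  exterior : ∀ (K : M.Cell) (i : Fin 3), M.nbrs K i = ∅ → ∀ x ∈ edge K.1 i,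
    inner ℝ (v K x) (outwardNormal K.1 i) = 0

/-- The value `(v · n_{K,σ})_σ` of the normal component of `v` on an edge. -/
def normalFlux (v : M.P1dVec) (K : M.Cell) (i : Fin 3) : ℝ :=
  inner ℝ (v K (edgeMid K.1 i)) (outwardNormal K.1 i)

/-! ### Projections -/

variable (M) in
/-- The `L²` projection on piecewise constants: mean values over the triangles. -/
def proj0 {F : Type*} [NormedAddCommGroup F] [NormedSpace ℝ F] (g : Plane → F) : M.Cell → F :=
  fun K => ⨍ x in K.1.closedInterior, g x

/-- `r` is the `L²` projection on `P_1^{nc}` of the piecewise constant function `q`. -/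
def IsProjP1nc (q : M.P0) (r : M.P1d) : Prop :=
  IsP1nc r ∧ ∀ ψ : M.P1d, IsP1nc ψ →
    ∑ K : M.Cell, ∫ x in K.1.closedInterior, r K x * ψ K x =
      ∑ K : M.Cell, ∫ x in K.1.closedInterior, q K * ψ K x

/-- `u` is the `L²` projection on `RT_0` of the piecewise constant vector field `w`. -/
def IsProjRT0 (w : M.P0Vec) (u : M.P1dVec) : Prop :=
  IsRT0 u ∧ ∀ v : M.P1dVec, IsRT0 v →
    ∑ K : M.Cell, ∫ x in K.1.closedInterior, inner ℝ (u K x) (v K x) =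
      ∑ K : M.Cell, ∫ x in K.1.closedInterior, inner ℝ (w K) (v K x)

/-! ### Discrete operators -/

/-- The discrete gradient: the gradient of the affine function on each triangle. -/
def gradh (p : M.P1d) : M.P0Vec := fun K =>
  !₂[(p K).linear (EuclideanSpace.single 0 1), (p K).linear (EuclideanSpace.single 1 1)]

/-- `q ∈ P_1^{nc}` is the discrete divergence of `v`, given by its values at the middles of the
edges. -/
def IsDivh (v : M.P0Vec) (q : M.P1d) : Prop :=
  IsP1nc q ∧ ∀ (K : M.Cell) (i : Fin 3),
    (∀ L ∈ M.nbrs K i, q K (edgeMid K.1 i) =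
      3 * edgeLength K.1 i / (area K.1 + area L.1) * inner ℝ (v L - v K) (outwardNormal K.1 i)) ∧
    (M.nbrs K i = ∅ → q K (edgeMid K.1 i) =
      - (3 * edgeLength K.1 i / area K.1) * inner ℝ (v K) (outwardNormal K.1 i))

/-- The finite volume laplacian; the sum over `i` and over the neighbours through the `i`-th edge is
the sum over the interior edges of `K`. -/
def lapl (q : M.P0) : M.P0 := fun K =>
  (area K.1)⁻¹ * ∑ i : Fin 3, ∑ L ∈ M.nbrs K i,
    edgeLength K.1 i / dist K.1.circumcenter L.1.circumcenter * (q L - q K)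

/-- The upwind discretization of `div (q v)`. -/
def upwind (v : M.P1dVec) (q : M.P0) : M.P0 := fun K =>
  (area K.1)⁻¹ * ∑ i : Fin 3, ∑ L ∈ M.nbrs K i,
    edgeLength K.1 i * (max (normalFlux v K i) 0 * q K + min (normalFlux v K i) 0 * q L)

end TriMesh

/-! ### The scheme -/

open TriMesh

/-- `(p, u)` is the discrete pressure and velocity at time `t` belonging to the discrete
concentration `c` and temperature `θ`:
`div_h (κ ∇_h p) = div_h f_h - Π s_h` with `p ∈ P_1^{nc} ∩ L²_0`, and
`u = Π (f_h - κ ∇_h p)` with `Π` the `L²` projections on `P_1^{nc}` and on `RT_0`. -/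
structure IsDarcyStep (d : TransportData) {M : TriMesh d.Ω} (t : ℝ) (c θ : M.P0) (p : M.P1d)
    (u : M.P1dVec) : Prop where
  p_nc : IsP1nc p
  p_mean : HasZeroMean p
  pressure : ∃ a b r : M.P1d,
    IsDivh (fun K => d.κ (c K) (θ K) • gradh p K) a ∧ IsDivh (M.proj0 (d.f t)) b ∧
      IsProjP1nc (M.proj0 d.s) r ∧ a = b - r
  velocity : IsProjRT0 (fun K => M.proj0 (d.f t) K - d.κ (c K) (θ K) • gradh p K) u

/-- `(c m, θ m, p m, u m)`, `0 ≤ m ≤ N`, is the solution of the scheme with time step `T / N` on the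
mesh `M`; the velocity at time `0` is obtained from the initial concentration and temperature
in the same way as at the later times. -/
structure IsDiscreteSolution (d : TransportData) (M : TriMesh d.Ω) (N : ℕ)
    (c θ : ℕ → M.P0) (p : ℕ → M.P1d) (u : ℕ → M.P1dVec) : Prop where
  c_init : c 0 = M.proj0 d.c₀
  θ_init : θ 0 = M.proj0 d.θ₀
  c_step : ∀ n < N, ∀ K : M.Cell,
    (c (n + 1) K - c n K) / (d.T / N) - d.Dc * lapl (c (n + 1)) K =
      M.proj0 d.sc K - (M.proj0 d.s K + d.lam) * c (n + 1) K - upwind (u n) (c (n + 1)) K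
  θ_step : ∀ n < N, ∀ K : M.Cell,
    (θ (n + 1) K - θ n K) / (d.T / N) - d.Dθ * lapl (θ (n + 1)) K =
      - M.proj0 d.sθ K - M.proj0 d.s K * (θ (n + 1) K - d.θref) - upwind (u n) (θ (n + 1)) K
  darcy : ∀ m ≤ N, IsDarcyStep d (m * (d.T / N)) (c m) (θ m) (p m) (u m)

/-- The piecewise constant function of time with values in `P_0` equal to `w (n + 1)` on
`(t_n, t_{n+1}] ∩ (0,T)`, where `t_n = n T / N`, and to zero outside `(0,T)`. -/
def stepInTime {Ω : Set Plane} {M : TriMesh Ω} (T : ℝ) (N : ℕ) (w : ℕ → M.P0) : ℝ → M.P0 :=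
  indicator (Ioo 0 T) fun t => w ⌈t / (T / N)⌉₊

/-- The Fourier transform in time `ŵ(τ)` of a function of time with values in `P_0`, as a complex
function on the plane. The Fourier transform is `ŵ(τ) = ∫ exp (-2 i π τ t) w(t) dt`. -/
def timeFourier {Ω : Set Plane} {M : TriMesh Ω} (w : ℝ → M.P0) (τ : ℝ) : Plane → ℂ :=
  fun x => 𝓕 (fun t : ℝ => ((P0.toFun (w t) x : ℝ) : ℂ)) τ

end NuclearTransport

end

open NuclearTransport

/-!
The bounds `2 (θ₋ - θ_*) s + s_θ ≤ 0 ≤ 2 (θ₊ - θ_*) s + s_θ` force `s ≥ 0`, while the pressure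
equation, a discrete pure Neumann problem, is solvable only if its source has mean zero; hence `s`
and `s_θ` vanish on the mesh (`source_ae_eq_zero`). With no source the pressure equation says that
the piecewise constant field `w = 𝐟ₕ - κₕ ∇ₕ pₕ` has continuous normal components, so `w` lies in
`𝐑𝐓₀`, the projected velocity `𝐮ₕ` has the normal fluxes of `w`, and these fluxes balance on each
cell (`isConstRT0_of_source_eq_zero`, `IsProjRT0.normalFlux_eq`,
`IsDarcyStep.hasBalancedFlux`). Therefore the upwind scheme is monotone and satisfies a discrete
maximum principle (`IsStep.le`, `IsStep.ge`), which bounds `cₕ` and `θₕ` pointwise.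
As `w` is orthogonal to the gradients of `P₁ⁿᶜ`, the pressure has bounded energy, and the fluxes
are bounded in a weighted `ℓ²` norm on regular meshes (`sum_area_norm_sq_le`, `Regular.sqFlux_le`).

For such a bounded evolution the energy identity bounds the discrete `L²(0,T; H¹)` norm. Let `G τ`
be the square of the discrete `H¹` seminorm of `ŵ(τ)`; by Plancherel, `∫ G` is bounded. Taking the
Fourier transform of the equation in time, by a summation by parts over the steps, and testing with
the conjugate of `ŵ(τ)` gives `|τ| |ŵ(τ)|² ≤ C (√(G τ) + |ŵ(τ)|)` (`abs_mul_sqL2_le`): the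
right-hand side of the scheme is bounded in `L¹(0,T)` with values in the dual of the discrete `H¹`
norm, uniformly in `τ`, and the jumps at `0` and `T` are bounded in `L²`. By Young's inequality,
`|τ|^{2γ} |ŵ(τ)|²` is at most a multiple of `(1 + |τ|)^{-(2 - 4γ)} + |ŵ(τ)|² + G τ` (`rpow_mul_le`),
which is integrable because `2 - 4γ > 1` exactly when `γ < 1/4`.
-/

namespace NuclearTransport

/-! ### Plane triangles -/

/-- The cross product (signed area of the parallelogram) of two plane vectors. -/
def cross (a b : Plane) : ℝ := a 0 * b 1 - a 1 * b 0

/-- The rotation of the plane by a quarter turn, clockwise. -/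
def rot (a : Plane) : Plane := !₂[a 1, -a 0]

/-- Twice the signed area of a triangle. -/
def det (K : Affine.Triangle ℝ Plane) : ℝ :=
  cross (K.points 1 - K.points 0) (K.points 2 - K.points 0)

/-- The `i`-th barycentric coordinate with respect to a triangle. -/
noncomputable def bary (K : Affine.Triangle ℝ Plane) (i : Fin 3) (x : Plane) : ℝ :=
  cross (K.points (i + 1) - x) (K.points (i + 2) - x) / det K

lemma inner_eq (a b : Plane) : inner ℝ a b = a 0 * b 0 + a 1 * b 1 := by
  simp [PiLp.inner_apply, Fin.sum_univ_two, mul_comm]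

lemma norm_sq_eq (a : Plane) : ‖a‖ ^ 2 = a 0 ^ 2 + a 1 ^ 2 := by
  simp [EuclideanSpace.norm_sq_eq, Fin.sum_univ_two]

lemma inner_rot (a b : Plane) : inner ℝ a (rot b) = cross a b := by
  simp [inner_eq, rot, cross]; ring

lemma norm_rot (a : Plane) : ‖rot a‖ = ‖a‖ := by
  have : ‖rot a‖ ^ 2 = ‖a‖ ^ 2 := by simp [norm_sq_eq, rot]; ring
  simpa [abs_of_nonneg] using (sq_eq_sq₀ (norm_nonneg _) (norm_nonneg _)).1 this

lemma plane_ext {a b : Plane} (h0 : a 0 = b 0) (h1 : a 1 = b 1) : a = b := by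
  ext i; fin_cases i <;> assumption

lemma det_eq (K : Affine.Triangle ℝ Plane) (i : Fin 3) :
    det K = cross (K.points (i + 1) - K.points i) (K.points (i + 2) - K.points i) := by
  fin_cases i <;> simp [det, cross] <;> ring

lemma det_ne_zero (K : Affine.Triangle ℝ Plane) : det K ≠ 0 := by
  intro h
  have hi := affineIndependent_iff.1 K.independent Finset.univ
  have key : ∀ a b : ℝ, a • (K.points 1 - K.points 0) + b • (K.points 2 - K.points 0) = 0 →
      a = 0 ∧ b = 0 := by
    intro a b hab
    have := hi ![-a - b, a, b] (by simp [Fin.sum_univ_three]; ring)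
      (by rw [← hab]; simp [Fin.sum_univ_three]; module)
    exact ⟨by simpa using this 1, by simpa using this 2⟩
  set u := K.points 1 - K.points 0
  set v := K.points 2 - K.points 0
  have h' : u 0 * v 1 - u 1 * v 0 = 0 := h
  have h1 := key (v 1) (-u 1) (plane_ext (by simp; linarith) (by simp; ring))
  have h0 := key (v 0) (-u 0) (plane_ext (by simp; ring) (by simp; linarith))
  have := key 0 1 (plane_ext (by simp [h0]) (by simp [h1]))
  simp at this

lemma bary_sum (K : Affine.Triangle ℝ Plane) (x : Plane) : ∑ i, bary K i x = 1 := by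
  have h := det_ne_zero K
  simp only [bary, Fin.sum_univ_three, ← add_div]
  rw [div_eq_one_iff_eq h]
  simp [det, cross]; ring

lemma bary_combo_points (K : Affine.Triangle ℝ Plane) (x : Plane) :
    ∑ i, bary K i x • K.points i = x := by
  have h := det_ne_zero K
  have : det K • ∑ i, bary K i x • K.points i = det K • x := by
    have hs : ∀ i, det K • bary K i x • K.points i =
        cross (K.points (i + 1) - x) (K.points (i + 2) - x) • K.points i := fun i => by
      rw [smul_smul, bary, mul_div_cancel₀ _ h]
    rw [Finset.smul_sum, Finset.sum_congr rfl fun i _ => hs i, Fin.sum_univ_three]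
    refine plane_ext ?_ ?_ <;> simp [det, cross] <;> ring
  exact smul_right_injective _ h this

lemma bary_combo (K : Affine.Triangle ℝ Plane) (i : Fin 3) (x y : Plane) {s t : ℝ}
    (h : s + t = 1) : bary K i (s • x + t • y) = s * bary K i x + t * bary K i y := by
  obtain rfl : s = 1 - t := by linarith
  simp only [bary, ← mul_div_assoc, ← add_div]
  congr 1
  simp [cross]; ring

lemma bary_self (K : Affine.Triangle ℝ Plane) (i : Fin 3) : bary K i (K.points i) = 1 := by
  rw [bary, ← det_eq, div_self (det_ne_zero K)]

lemma bary_ne (K : Affine.Triangle ℝ Plane) {i j : Fin 3} (h : i ≠ j) :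
    bary K i (K.points j) = 0 := by
  fin_cases i <;> fin_cases j <;> first | exact absurd rfl h | (simp [bary, cross])

lemma bary_weights (K : Affine.Triangle ℝ Plane) (w : Fin 3 → ℝ) (hw : ∑ i, w i = 1) (i : Fin 3) :
    bary K i (∑ j, w j • K.points j) = w i := by
  have h := det_ne_zero K
  rw [bary, div_eq_iff h]
  have h0 : w 0 = 1 - w 1 - w 2 := by rw [Fin.sum_univ_three] at hw; linarith
  fin_cases i <;> simp [Fin.sum_univ_three, det, cross, h0] <;> ring

lemma continuous_bary (K : Affine.Triangle ℝ Plane) (i : Fin 3) : Continuous (bary K i) := by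
  unfold bary cross
  fun_prop

/-- The closed and open interiors of a triangle are described by its barycentric coordinates. -/
lemma mem_setInterior_iff (K : Affine.Triangle ℝ Plane) (I : Set ℝ) (x : Plane) :
    x ∈ K.setInterior I ↔ ∀ i, bary K i x ∈ I := by
  have key : ∀ w : Fin 3 → ℝ, ∑ i, w i = 1 →
      Finset.univ.affineCombination ℝ K.points w = ∑ i, w i • K.points i := fun w hw =>
    Finset.affineCombination_eq_linear_combination _ _ _ hw
  constructor
  · rintro ⟨w, hw, hI, rfl⟩ i
    rw [key w hw, bary_weights K w hw]
    exact hI i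
  · intro h
    exact ⟨fun i => bary K i x, bary_sum K x, h, by rw [key _ (bary_sum K x), bary_combo_points]⟩

lemma mem_closedInterior_iff (K : Affine.Triangle ℝ Plane) (x : Plane) :
    x ∈ K.closedInterior ↔ ∀ i, 0 ≤ bary K i x := by
  rw [Affine.Simplex.closedInterior, mem_setInterior_iff]
  refine ⟨fun h i => (h i).1, fun h i => ⟨h i, ?_⟩⟩
  rw [← bary_sum K x]
  exact Finset.single_le_sum (fun j _ => h j) (Finset.mem_univ i)

lemma bary_pos_of_mem_interior {K : Affine.Triangle ℝ Plane} {x : Plane} (h : x ∈ K.interior)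
    (i : Fin 3) : 0 < bary K i x :=
  ((mem_setInterior_iff K _ x).1 h i).1

lemma edgeMid_eq (K : Affine.Triangle ℝ Plane) (i : Fin 3) :
    edgeMid K i = (1 / 2 : ℝ) • K.points (i + 1) + (1 / 2 : ℝ) • K.points (i + 2) := by
  rw [edgeMid, midpoint_eq_smul_add, smul_add]; norm_num

lemma edgeMid_mem (K : Affine.Triangle ℝ Plane) (i : Fin 3) : edgeMid K i ∈ K.closedInterior := by
  rw [mem_closedInterior_iff]
  intro j
  rw [edgeMid_eq, bary_combo K j _ _ (by norm_num)]
  have : ∀ l, 0 ≤ bary K j (K.points l) := fun l => by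
    by_cases h : j = l
    · rw [h, bary_self]; exact zero_le_one
    · rw [bary_ne K h]
  have h1 := this (i + 1)
  have h2 := this (i + 2)
  positivity

/-- The orientation of a triangle, as a number `±1`. -/
noncomputable def orient (K : Affine.Triangle ℝ Plane) : ℝ := det K / |det K|

lemma orient_mul_det (K : Affine.Triangle ℝ Plane) : orient K * det K = |det K| := by
  have := det_ne_zero K
  rw [orient, div_mul_eq_mul_div, div_eq_iff (by simpa), abs_mul_abs_self]

lemma abs_orient (K : Affine.Triangle ℝ Plane) : |orient K| = 1 := by
  rw [orient, abs_div, abs_abs, div_self (by simpa using det_ne_zero K)]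

lemma edgeLength_pos (K : Affine.Triangle ℝ Plane) (i : Fin 3) : 0 < edgeLength K i := by
  refine dist_pos.2 fun h => ?_
  have := K.independent.injective h
  fin_cases i <;> simp at this

/-- The outward normal is defined by the altitude from the opposite vertex; it is the direction of
the edge turned by a right angle, away from the triangle. -/
lemma outwardNormal_eq (K : Affine.Triangle ℝ Plane) (i : Fin 3) :
    outwardNormal K i =
      (orient K / edgeLength K i) • rot (K.points (i + 2) - K.points (i + 1)) := by
  have hd := det_ne_zero K
  have hl := edgeLength_pos K i
  set e := K.points (i + 2) - K.points (i + 1) with he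
  have hle : ‖e‖ = edgeLength K i := by rw [edgeLength, dist_comm, dist_eq_norm]
  set w := K.altitudeFoot i - K.points i with hw
  have hspan : affineSpan ℝ (K.points '' {i}ᶜ) =
      affineSpan ℝ {K.points (i + 1), K.points (i + 2)} := by
    congr 1
    have : ({i}ᶜ : Set (Fin 3)) = {i + 1, i + 2} := by
      ext j; fin_cases i <;> fin_cases j <;> simp
    rw [this, image_pair]
  have horth : inner ℝ e w = 0 := by
    have h1 := EuclideanGeometry.vsub_orthogonalProjection_mem_direction_orthogonal
      (affineSpan ℝ (Set.range (K.faceOpposite i).points)) (K.points i)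
    rw [Submodule.mem_orthogonal] at h1
    have h2 := h1 e (by
      rw [Affine.Simplex.range_faceOpposite_points, hspan]
      exact AffineSubspace.vsub_mem_direction (right_mem_affineSpan_pair ..)
        (left_mem_affineSpan_pair ..))
    have h3 : w = -(K.points i -ᵥ (K.altitudeFoot i)) := by rw [hw, vsub_eq_sub, neg_sub]
    rw [h3, inner_neg_right, neg_eq_zero]
    exact h2
  obtain ⟨t, ht⟩ : ∃ t : ℝ, K.altitudeFoot i = K.points (i + 1) + t • e := by
    have := K.altitudeFoot_mem_affineSpan_image_compl i
    rw [hspan, mem_affineSpan_pair_iff_exists_lineMap_eq] at this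
    obtain ⟨t, ht⟩ := this
    refine ⟨t, ?_⟩
    rw [← ht, AffineMap.lineMap_apply, vsub_eq_sub, vadd_eq_add, add_comm]
  have hcr : cross w e = det K := by
    rw [hw, ht, det_eq K i, he]
    simp [cross]; ring
  have hne : e 0 ^ 2 + e 1 ^ 2 ≠ 0 := by
    rw [← norm_sq_eq, hle]; positivity
  have hwe : w = (det K / edgeLength K i ^ 2) • rot e := by
    rw [inner_eq] at horth
    rw [← hle, norm_sq_eq, ← hcr]
    refine plane_ext ?_ ?_
    · simp [rot, cross]; field_simp; linear_combination e 0 * horth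
    · simp [rot, cross]; field_simp; linear_combination e 1 * horth
  rw [outwardNormal, ← hw, hwe, norm_smul, norm_rot, hle, smul_smul]
  congr 1
  rw [Real.norm_eq_abs, abs_div, abs_of_pos (pow_pos hl 2), orient]
  have : |det K| ≠ 0 := by simpa
  field_simp

lemma edgeLength_smul_outwardNormal (K : Affine.Triangle ℝ Plane) (i : Fin 3) :
    edgeLength K i • outwardNormal K i =
      orient K • rot (K.points (i + 2) - K.points (i + 1)) := by
  rw [outwardNormal_eq, smul_smul, mul_div_cancel₀ _ (edgeLength_pos K i).ne']

lemma norm_outwardNormal (K : Affine.Triangle ℝ Plane) (i : Fin 3) : ‖outwardNormal K i‖ = 1 := by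
  have hl := edgeLength_pos K i
  rw [outwardNormal_eq, norm_smul, norm_rot, Real.norm_eq_abs, abs_div, abs_orient, abs_of_pos hl,
    ← dist_eq_norm, dist_comm, ← edgeLength]
  field_simp

/-- The divergence formula for a constant field: `∑ |σ| n_{K,σ} = 0`. -/
lemma sum_edgeLength_inner_outwardNormal (K : Affine.Triangle ℝ Plane) (w : Plane) :
    ∑ i, edgeLength K i * inner ℝ w (outwardNormal K i) = 0 := by
  simp only [← inner_smul_right, edgeLength_smul_outwardNormal, ← inner_sum, ← Finset.smul_sum]
  have : ∑ i : Fin 3, rot (K.points (i + 2) - K.points (i + 1)) = 0 := by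
    refine plane_ext ?_ ?_ <;> simp [Fin.sum_univ_three, rot]
  simp [this]

/-- The divergence formula for `p w`, with `p` affine and `w` constant. -/
lemma sum_edgeLength_edgeMid_inner (K : Affine.Triangle ℝ Plane) (p : Plane →ᵃ[ℝ] ℝ) (w : Plane) :
    ∑ i, edgeLength K i * p (edgeMid K i) * inner ℝ w (outwardNormal K i) =
      |det K| / 2 * inner ℝ w
        !₂[p.linear (EuclideanSpace.single 0 1), p.linear (EuclideanSpace.single 1 1)] := by
  set a := p.linear (EuclideanSpace.single 0 1)
  set b := p.linear (EuclideanSpace.single 1 1)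
  have hp : ∀ x, p x = p 0 + (x 0 * a + x 1 * b) := by
    intro x
    have h := p.map_vadd 0 x
    have hx : x = x 0 • EuclideanSpace.single 0 (1 : ℝ) + x 1 • EuclideanSpace.single 1 1 :=
      plane_ext (by simp) (by simp)
    simp only [vadd_eq_add, add_zero] at h
    rw [h, hx, map_add, map_smul, map_smul]
    simp [a, b]; ring
  have : ∀ i, edgeLength K i * p (edgeMid K i) * inner ℝ w (outwardNormal K i) =
      p (edgeMid K i) *
        (orient K * cross w (K.points (i + 2) - K.points (i + 1))) := by
    intro i
    rw [mul_right_comm, ← inner_smul_right, edgeLength_smul_outwardNormal, inner_smul_right,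
      inner_rot, mul_comm]
  rw [Finset.sum_congr rfl fun i _ => this i, ← orient_mul_det, Fin.sum_univ_three, hp (edgeMid K 0),
    hp (edgeMid K 1), hp (edgeMid K 2)]
  generalize p 0 = p0, orient K = o, a = a, b = b
  simp [inner_eq, cross, det, edgeMid_eq]
  ring

/-- `a b c = 2 R |D|`, squared, where `R` is the circumradius and `D` twice the signed area. -/
lemma edgeLength_prod_sq (K : Affine.Triangle ℝ Plane) :
    (edgeLength K 0 * edgeLength K 1 * edgeLength K 2) ^ 2 =
      (2 * K.circumradius) ^ 2 * det K ^ 2 := by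
  have h0 : ‖K.points 0 - K.circumcenter‖ ^ 2 = K.circumradius ^ 2 := by
    rw [← dist_eq_norm, K.dist_circumcenter_eq_circumradius 0]
  have h1 : ‖K.points 1 - K.circumcenter‖ ^ 2 = K.circumradius ^ 2 := by
    rw [← dist_eq_norm, K.dist_circumcenter_eq_circumradius 1]
  have h2 : ‖K.points 2 - K.circumcenter‖ ^ 2 = K.circumradius ^ 2 := by
    rw [← dist_eq_norm, K.dist_circumcenter_eq_circumradius 2]
  simp only [mul_pow, edgeLength, dist_eq_norm]
  rw [← h0] at h1 h2 ⊢
  have key : ∀ a b c d s t : ℝ, 2 * (a * s + b * t) = a ^ 2 + b ^ 2 →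
      2 * (c * s + d * t) = c ^ 2 + d ^ 2 →
      (a ^ 2 + b ^ 2) * (c ^ 2 + d ^ 2) * ((c - a) ^ 2 + (d - b) ^ 2) =
        4 * (s ^ 2 + t ^ 2) * (a * d - b * c) ^ 2 := by
    intro a b c d s t e1 e2
    have f1 : 2 * ((a * d - b * c) * s) = (a ^ 2 + b ^ 2) * d - (c ^ 2 + d ^ 2) * b := by
      linear_combination d * e1 - b * e2
    have f2 : 2 * ((a * d - b * c) * t) = a * (c ^ 2 + d ^ 2) - c * (a ^ 2 + b ^ 2) := by
      linear_combination a * e2 - c * e1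
    have : 4 * (s ^ 2 + t ^ 2) * (a * d - b * c) ^ 2 =
      (2 * ((a * d - b * c) * s)) ^ 2 + (2 * ((a * d - b * c) * t)) ^ 2 := by ring
    rw [this, f1, f2]; ring
  simp only [norm_sq_eq, det, cross, Fin.isValue, PiLp.sub_apply] at *
  have := key (K.points 1 0 - K.points 0 0) (K.points 1 1 - K.points 0 1)
    (K.points 2 0 - K.points 0 0) (K.points 2 1 - K.points 0 1)
    (K.circumcenter 0 - K.points 0 0) (K.circumcenter 1 - K.points 0 1) (by linarith) (by linarith)
  simp
  linear_combination this

lemma edgeLength_le (K : Affine.Triangle ℝ Plane) (i : Fin 3) :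
    edgeLength K i ≤ 2 * K.circumradius := by
  rw [edgeLength]
  refine (dist_triangle_right _ _ K.circumcenter).trans ?_
  rw [K.dist_circumcenter_eq_circumradius, K.dist_circumcenter_eq_circumradius, two_mul]

/-- A segment determines its unordered pair of endpoints. -/
lemma endpoints_eq_of_segment_eq {A B C D : Plane} (h : segment ℝ A B = segment ℝ C D) :
    (A = C ∧ B = D) ∨ (A = D ∧ B = C) := by
  have hA : A ∈ segment ℝ C D := h ▸ left_mem_segment ℝ A B
  have hB : B ∈ segment ℝ C D := h ▸ right_mem_segment ℝ A B
  have hC : C ∈ segment ℝ A B := h ▸ left_mem_segment ℝ C D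
  have hD : D ∈ segment ℝ A B := h ▸ right_mem_segment ℝ C D
  rw [segment_eq_image'] at *
  obtain ⟨s, ⟨hs0, hs1⟩, rfl⟩ := hA
  obtain ⟨t, ⟨ht0, ht1⟩, rfl⟩ := hB
  obtain ⟨a, ⟨ha0, ha1⟩, hC⟩ := hC
  obtain ⟨b, ⟨hb0, hb1⟩, hD⟩ := hD
  by_cases hd : D - C = 0
  · simp [sub_eq_zero.1 hd]
  have h1 : (s + a * (t - s)) • (D - C) = 0 := by
    have : (s + a * (t - s)) • (D - C) =
        (C + s • (D - C) + a • (C + t • (D - C) - (C + s • (D - C)))) - C := by module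
    rw [this]; simp only at hC; rw [hC, sub_self]
  have h2 : (s + b * (t - s) - 1) • (D - C) = 0 := by
    have : (s + b * (t - s) - 1) • (D - C) =
        (C + s • (D - C) + b • (C + t • (D - C) - (C + s • (D - C)))) - D := by module
    rw [this]; simp only at hD; rw [hD, sub_self]
  replace h1 := (smul_eq_zero.1 h1).resolve_right hd
  replace h2 := (smul_eq_zero.1 h2).resolve_right hd
  have e1 : (1 - a) * s = 0 := by nlinarith [mul_nonneg (sub_nonneg.2 ha1) hs0, mul_nonneg ha0 ht0]
  have e2 : a * t = 0 := by nlinarith [mul_nonneg (sub_nonneg.2 ha1) hs0, mul_nonneg ha0 ht0]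
  rcases mul_eq_zero.1 e1 with h | h
  · obtain rfl : a = 1 := by linarith
    obtain rfl : t = 0 := by linarith
    have : s = 1 := by nlinarith
    subst this
    right; simp
  · subst h
    have : t = 1 := by nlinarith
    subst this
    left; simp

/-! ### Integrals over a triangle -/

/-- The integral of an affine function over the reference triangle. -/
lemma setIntegral_refTriangle (α β γ : ℝ) :
    ∫ z in {z : ℝ × ℝ | 0 ≤ z.1 ∧ 0 ≤ z.2 ∧ z.1 + z.2 ≤ 1}, (α + β * z.1 + γ * z.2) =
      α / 2 + β / 6 + γ / 6 := by
  set S : Set (ℝ × ℝ) := {z | 0 ≤ z.1 ∧ 0 ≤ z.2 ∧ z.1 + z.2 ≤ 1}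
  have hScl : IsClosed S := by
    refine (isClosed_le continuous_const continuous_fst).inter
      ((isClosed_le continuous_const continuous_snd).inter
        (isClosed_le (continuous_fst.add continuous_snd) continuous_const))
  have hSb : S ⊆ Icc (0 : ℝ) 1 ×ˢ Icc (0 : ℝ) 1 := fun z hz =>
    ⟨⟨hz.1, by linarith [hz.1, hz.2.1, hz.2.2]⟩, ⟨hz.2.1, by linarith [hz.1, hz.2.1, hz.2.2]⟩⟩
  have hSc : IsCompact S := (isCompact_Icc.prod isCompact_Icc).of_isClosed_subset hScl hSb
  have hint : IntegrableOn (fun z : ℝ × ℝ => α + β * z.1 + γ * z.2) S :=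
    ContinuousOn.integrableOn_compact hSc (by fun_prop)
  have hinner : ∀ x : ℝ, ∫ y, S.indicator (fun z : ℝ × ℝ => α + β * z.1 + γ * z.2) (x, y) =
      (Icc (0 : ℝ) 1).indicator
        (fun x => α * (1 - x) + β * x * (1 - x) + γ * ((1 - x) ^ 2 / 2)) x := by
    intro x
    by_cases hx : x ∈ Icc (0 : ℝ) 1
    · rw [indicator_of_mem hx]
      have : (fun y => S.indicator (fun z : ℝ × ℝ => α + β * z.1 + γ * z.2) (x, y)) =
          (Icc (0 : ℝ) (1 - x)).indicator (fun y => α + β * x + γ * y) := by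
        ext y
        simp only [indicator, S, mem_Icc, mem_ofPred_eq]
        refine if_congr ⟨fun h => ⟨h.2.1, by linarith⟩, fun h => ⟨hx.1, h.1, by linarith⟩⟩ rfl rfl
      rw [this, integral_indicator measurableSet_Icc, integral_Icc_eq_integral_Ioc,
        ← intervalIntegral.integral_of_le (by linarith [hx.2]),
        intervalIntegral.integral_add (by simp) (by apply Continuous.intervalIntegrable; fun_prop),
        intervalIntegral.integral_const, intervalIntegral.integral_const_mul, integral_id]
      simp; ring
    · rw [indicator_of_notMem hx]
      refine integral_eq_zero_of_ae (Filter.Eventually.of_forall fun y => ?_)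
      refine indicator_of_notMem (fun h => hx (hSb h).1) _
  rw [← integral_indicator hScl.measurableSet, Measure.volume_eq_prod,
    integral_prod _ ((integrable_indicator_iff hScl.measurableSet).2 hint)]
  simp only [hinner]
  rw [integral_indicator measurableSet_Icc, integral_Icc_eq_integral_Ioc,
    ← intervalIntegral.integral_of_le zero_le_one]
  have : ∀ x ∈ uIcc (0 : ℝ) 1, HasDerivAt (fun x : ℝ => α * (x - x ^ 2 / 2) +
      β * (x ^ 2 / 2 - x ^ 3 / 3) - γ * ((1 - x) ^ 3 / 6))
      (α * (1 - x) + β * x * (1 - x) + γ * ((1 - x) ^ 2 / 2)) x := by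
    intro x _
    have h := (((hasDerivAt_id x).sub (((hasDerivAt_id x).pow 2).div_const 2)).const_mul α).add
      (((((hasDerivAt_id x).pow 2).div_const 2).sub
        (((hasDerivAt_id x).pow 3).div_const 3)).const_mul β) |>.sub
      (((((hasDerivAt_id x).const_sub 1).pow 3).div_const 6).const_mul γ)
    refine HasDerivAt.congr_deriv h ?_
    simp only [id, Nat.cast_ofNat]; ring
  rw [intervalIntegral.integral_eq_sub_of_hasDerivAt this
    (by apply Continuous.intervalIntegrable; fun_prop)]
  norm_num; ring

/-- The affine parametrization of a triangle by the reference triangle. -/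
lemma setIntegral_closedInterior (K : Affine.Triangle ℝ Plane) (g : Plane → ℝ) :
    ∫ x in K.closedInterior, g x = |det K| *
      ∫ z in {z : ℝ × ℝ | 0 ≤ z.1 ∧ 0 ≤ z.2 ∧ z.1 + z.2 ≤ 1},
        g (K.points 0 + (z.1 • (K.points 1 - K.points 0) + z.2 • (K.points 2 - K.points 0))) := by
  have hd := det_ne_zero K
  set u := K.points 1 - K.points 0 with hu
  set v := K.points 2 - K.points 0 with hv
  set S : Set (ℝ × ℝ) := {z | 0 ≤ z.1 ∧ 0 ≤ z.2 ∧ z.1 + z.2 ≤ 1}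
  set R : Set Plane := {y | 0 ≤ y 0 ∧ 0 ≤ y 1 ∧ y 0 + y 1 ≤ 1} with hR
  set L : Plane →L[ℝ] Plane := LinearMap.toContinuousLinearMap
    { toFun := fun y => y 0 • u + y 1 • v
      map_add' := fun a b => by simp; module
      map_smul' := fun c a => by simp; module }
  have hL : ∀ y, L y = y 0 • u + y 1 • v := fun y => rfl
  have hdet : L.det = det K := by
    rw [ContinuousLinearMap.det,
      ← LinearMap.det_toMatrix (EuclideanSpace.basisFun (Fin 2) ℝ).toBasis, Matrix.det_fin_two]
    simp [LinearMap.toMatrix_apply, L, det, cross, hu, hv]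
    ring
  have hRm : MeasurableSet R := by
    have h0 : Continuous fun y : Plane => y 0 := by fun_prop
    have h1 : Continuous fun y : Plane => y 1 := by fun_prop
    have : IsClosed R := (isClosed_le continuous_const h0).inter
      ((isClosed_le continuous_const h1).inter (isClosed_le (h0.add h1) continuous_const))
    exact this.measurableSet
  have hb : ∀ y : Plane, bary K 1 (K.points 0 + L y) = y 0 ∧ bary K 2 (K.points 0 + L y) = y 1 := by
    intro y
    have : K.points 0 + L y = ∑ i, (![1 - y 0 - y 1, y 0, y 1] : Fin 3 → ℝ) i • K.points i := by
      simp [Fin.sum_univ_three, hL, hu, hv]; module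
    rw [this, bary_weights _ _ (by simp [Fin.sum_univ_three]; ring),
      bary_weights _ _ (by simp [Fin.sum_univ_three]; ring)]
    simp
  have himg : K.closedInterior = (fun y => K.points 0 + L y) '' R := by
    ext x
    rw [mem_closedInterior_iff]
    have hs := bary_sum K x
    rw [Fin.sum_univ_three] at hs
    constructor
    · intro h
      refine ⟨!₂[bary K 1 x, bary K 2 x], ⟨by simpa using h 1, by simpa using h 2,
        by simp; linarith [h 0]⟩, ?_⟩
      have := bary_combo_points K x
      simp only [hL, Fin.sum_univ_three] at this ⊢
      conv_rhs => rw [← this]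
      have h0 : bary K 0 x = 1 - bary K 1 x - bary K 2 x := by linarith
      rw [h0, hu, hv]; simp; module
    · rintro ⟨y, hy, rfl⟩ i
      obtain ⟨h1, h2⟩ := hb y
      simp only [h1, h2] at hs
      fin_cases i
      · have := hy.2.2; simp; linarith
      · simpa [h1] using hy.1
      · simpa [h2] using hy.2.1
  have hinj : InjOn (fun y => K.points 0 + L y) R := by
    intro a _ b _ hab
    have ha := hb a
    have hb := hb b
    simp only at hab
    rw [hab] at ha
    exact plane_ext (ha.1.symm.trans hb.1) (ha.2.symm.trans hb.2)
  rw [himg, integral_image_eq_integral_abs_det_fderiv_smul volume hRm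
    (fun x _ => ((L.hasFDerivAt).const_add _).hasFDerivWithinAt) hinj, hdet]
  simp only [smul_eq_mul, integral_const_mul]
  congr 1
  have e1 := (EuclideanSpace.volume_preserving_symm_measurableEquiv_toLp (Fin 2)).symm
  have e2 := (volume_preserving_finTwoArrow ℝ)
  have e := e2.comp e1.symm
  have hemb := ((MeasurableEquiv.toLp 2 (Fin 2 → ℝ)).symm.trans
    (MeasurableEquiv.finTwoArrow (α := ℝ))).measurableEmbedding
  have hpre : R = (fun y : Plane => (y 0, y 1)) ⁻¹' S := rfl
  rw [hpre]
  exact MeasurePreserving.setIntegral_preimage_emb (f := fun y : Plane => (y 0, y 1)) e hemb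
    (fun z => g (K.points 0 + (z.1 • u + z.2 • v))) S

lemma area_eq (K : Affine.Triangle ℝ Plane) : area K = |det K| / 2 := by
  have h := setIntegral_closedInterior K fun _ => 1
  have h2 := setIntegral_refTriangle 1 0 0
  simp only [zero_mul, add_zero] at h2
  rw [h2] at h
  rw [area, ← mul_one (volume.real _), ← smul_eq_mul, ← setIntegral_const, h]
  ring

lemma area_pos (K : Affine.Triangle ℝ Plane) : 0 < area K := by
  rw [area_eq]; have := abs_pos.2 (det_ne_zero K); positivity

/-- The midpoint rule, exact on affine functions. -/
lemma setIntegral_affine (K : Affine.Triangle ℝ Plane) (p : Plane →ᵃ[ℝ] ℝ) :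
    ∫ x in K.closedInterior, p x = area K / 3 * ∑ i, p (edgeMid K i) := by
  have hp : ∀ a b : ℝ, p (K.points 0 + (a • (K.points 1 - K.points 0) +
      b • (K.points 2 - K.points 0))) = p (K.points 0) +
        p.linear (K.points 1 - K.points 0) * a + p.linear (K.points 2 - K.points 0) * b := by
    intro a b
    rw [add_comm (K.points 0), ← vadd_eq_add, p.map_vadd, map_add, map_smul, map_smul]
    simp; ring
  have hm : ∀ i, p (edgeMid K i) = (p (K.points (i + 1)) + p (K.points (i + 2))) / 2 := by
    intro i
    rw [edgeMid, p.map_midpoint, midpoint_eq_smul_add]; simp; ring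
  have hq : ∀ i, p (K.points i) = p (K.points 0) + p.linear (K.points i - K.points 0) := by
    intro i
    rw [← vsub_eq_sub, p.linearMap_vsub]; simp
  rw [setIntegral_closedInterior]
  simp only [hp]
  rw [setIntegral_refTriangle, area_eq, Fin.sum_univ_three, hm, hm, hm]
  simp only [Fin.isValue, Fin.reduceAdd, zero_add]
  rw [hq 1, hq 2]
  ring

lemma measure_closedInterior_lt_top (K : Affine.Triangle ℝ Plane) : volume K.closedInterior < ⊤ :=
  K.isCompact_closedInterior.measure_lt_top

lemma measurableSet_closedInterior (K : Affine.Triangle ℝ Plane) :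
    MeasurableSet K.closedInterior := K.isClosed_closedInterior.measurableSet

lemma isOpen_interior (K : Affine.Triangle ℝ Plane) : IsOpen K.interior := by
  have : K.interior = ⋂ i, bary K i ⁻¹' Ioo 0 1 := by
    ext x; rw [Affine.Simplex.interior, mem_setInterior_iff]; simp
  rw [this]
  exact isOpen_iInter_of_finite fun i => isOpen_Ioo.preimage (continuous_bary K i)

lemma interior_nonempty (K : Affine.Triangle ℝ Plane) : K.interior.Nonempty := by
  refine ⟨∑ i, (1 / 3 : ℝ) • K.points i, (mem_setInterior_iff K _ _).2 fun i => ?_⟩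
  rw [bary_weights K (fun _ => 1 / 3) (by norm_num)]
  norm_num

lemma closedInterior_subset_closure_interior (K : Affine.Triangle ℝ Plane) :
    K.closedInterior ⊆ closure (interior K.closedInterior) := by
  have hconv : Convex ℝ K.closedInterior := by
    rw [← K.convexHull_eq_closedInterior]; exact convex_convexHull _ _
  rw [hconv.closure_interior_eq_closure_of_nonempty_interior]
  · exact subset_closure
  · exact (interior_nonempty K).mono
      (interior_maximal K.interior_subset_closedInterior (isOpen_interior K))

/-- A continuous nonnegative function with vanishing integral over a triangle vanishes on it. -/
lemma eqOn_zero_of_setIntegral_eq_zero (K : Affine.Triangle ℝ Plane) {g : Plane → ℝ}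
    (hg : Continuous g) (h0 : ∀ x, 0 ≤ g x) (h : ∫ x in K.closedInterior, g x = 0) :
    EqOn g 0 K.closedInterior := by
  refine Measure.eqOn_of_ae_eq (μ := volume) ?_ hg.continuousOn continuousOn_const
    (closedInterior_subset_closure_interior K)
  exact (setIntegral_eq_zero_iff_of_nonneg_ae (Filter.Eventually.of_forall h0)
    (hg.continuousOn.integrableOn_compact K.isCompact_closedInterior)).1 h

/-- The line carrying an edge is negligible. -/
lemma volume_bary_eq_zero (K : Affine.Triangle ℝ Plane) (i : Fin 3) :
    volume {x | bary K i x = 0} = 0 := by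
  let s : AffineSubspace ℝ Plane :=
    { carrier := {x | bary K i x = 0}
      smul_vsub_vadd_mem' := by
        intro c p q r hp hq hr
        have e : c • (p -ᵥ q) +ᵥ r =
            (2 : ℝ) • ((1 / 2 : ℝ) • (c • p + (1 - c) • q) + (1 / 2 : ℝ) • r) +
              (-1 : ℝ) • q := by
          simp only [vsub_eq_sub, vadd_eq_add]; module
        simp only [mem_ofPred_eq] at hp hq hr ⊢
        rw [e, bary_combo K i _ _ (by norm_num), bary_combo K i _ _ (by norm_num),
          bary_combo K i _ _ (by ring), hp, hq, hr]
        ring }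
  have hs : s ≠ ⊤ := by
    intro h
    have : K.points i ∈ s := h ▸ AffineSubspace.mem_top ℝ Plane _
    have : bary K i (K.points i) = 0 := this
    rw [bary_self] at this
    exact one_ne_zero this
  exact Measure.addHaar_affineSubspace volume s hs

/-! ### Adjacency of the cells of a mesh -/

namespace TriMesh

variable {Ω : Set Plane} {M : TriMesh Ω}

lemma exists_point_notMem {K L : M.Cell} (h : K ≠ L) :
    ∃ i, K.1.points i ∉ range L.1.points := by
  by_contra! hc
  have hsub : range K.1.points ⊆ range L.1.points := by
    rintro _ ⟨i, rfl⟩; exact hc i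
  refine h (Subtype.ext (M.points_injOn _ K.2 _ L.2 ?_))
  refine Set.eq_of_subset_of_ncard_le hsub (le_of_eq ?_) (finite_range _)
  rw [← image_univ, ← image_univ, ncard_image_of_injective _ K.1.independent.injective,
    ncard_image_of_injective _ L.1.independent.injective]

/-- Two cells meet inside any edge line of the first one whose opposite vertex they do not share. -/
lemma bary_eq_zero_of_mem_inter {K L : M.Cell} {i : Fin 3}
    (h : K.1.points i ∉ range L.1.points) {x : Plane} (hK : x ∈ K.1.closedInterior)
    (hL : x ∈ L.1.closedInterior) : bary K.1 i x = 0 := by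
  have hx : x ∈ convexHull ℝ (range K.1.points ∩ range L.1.points) :=
    M.conforming _ K.2 _ L.2 ▸ ⟨hK, hL⟩
  have hconv : Convex ℝ {x | bary K.1 i x = 0} := by
    intro a ha b hb s t _ _ hst
    simp only [mem_ofPred_eq] at ha hb ⊢
    rw [bary_combo _ _ _ _ hst, ha, hb]; simp
  refine convexHull_min ?_ hconv hx
  rintro _ ⟨⟨j, rfl⟩, hj⟩
  exact bary_ne _ fun hij => h (hij ▸ hj)

lemma disjoint_interior {K L : M.Cell} (h : K ≠ L) : Disjoint K.1.interior L.1.interior := by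
  obtain ⟨i, hi⟩ := exists_point_notMem h
  refine disjoint_left.2 fun x hK hL => (bary_pos_of_mem_interior hK i).ne' ?_
  exact bary_eq_zero_of_mem_inter hi (K.1.interior_subset_closedInterior hK)
    (L.1.interior_subset_closedInterior hL)

lemma aedisjoint_closedInterior {K L : M.Cell} (h : K ≠ L) :
    AEDisjoint volume K.1.closedInterior L.1.closedInterior := by
  obtain ⟨i, hi⟩ := exists_point_notMem h
  exact measure_mono_null (fun x hx => bary_eq_zero_of_mem_inter hi hx.1 hx.2)
    (volume_bary_eq_zero K.1 i)

lemma mem_nbrs {K L : M.Cell} {i : Fin 3} :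
    L ∈ M.nbrs K i ↔ L ≠ K ∧ ∃ j, edge L.1 j = edge K.1 i := by
  simp [nbrs]

lemma edge_injective (K : Affine.Triangle ℝ Plane) : Function.Injective (edge K) := by
  intro i j h
  rcases endpoints_eq_of_segment_eq h with ⟨h1, _⟩ | ⟨h1, h2⟩
  · exact add_right_cancel (K.independent.injective h1)
  · have h1 := K.independent.injective h1
    have h2 := K.independent.injective h2
    have : ∀ i j : Fin 3, i + 1 = j + 2 → i + 2 = j + 1 → i = j := by decide
    exact this i j h1 h2

lemma edgeLength_eq_of_edge_eq {K L : Affine.Triangle ℝ Plane} {i j : Fin 3}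
    (h : edge L j = edge K i) : edgeLength L j = edgeLength K i := by
  rcases endpoints_eq_of_segment_eq h with ⟨h1, h2⟩ | ⟨h1, h2⟩
  · rw [edgeLength, h1, h2, edgeLength]
  · rw [edgeLength, h1, h2, edgeLength, dist_comm]

lemma edgeMid_eq_of_edge_eq {K L : Affine.Triangle ℝ Plane} {i j : Fin 3}
    (h : edge L j = edge K i) : edgeMid L j = edgeMid K i := by
  rcases endpoints_eq_of_segment_eq h with ⟨h1, h2⟩ | ⟨h1, h2⟩
  · rw [edgeMid, h1, h2, edgeMid]
  · rw [edgeMid, h1, h2, edgeMid, midpoint_comm]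

/-- The vertex of `K` opposite to an edge shared with `L` is not a vertex of `L`. -/
lemma opposite_notMem {K L : M.Cell} {i j : Fin 3} (hLK : L ≠ K) (h : edge L.1 j = edge K.1 i) :
    K.1.points i ∉ range L.1.points := by
  obtain ⟨l, hl⟩ := exists_point_notMem hLK.symm
  have : l = i := by
    by_contra hli
    have h12 : l = i + 1 ∨ l = i + 2 := by
      have : ∀ l i : Fin 3, l ≠ i → l = i + 1 ∨ l = i + 2 := by decide
      exact this l i hli
    apply hl
    rcases endpoints_eq_of_segment_eq h with ⟨h1, h2⟩ | ⟨h1, h2⟩ <;> rcases h12 with rfl | rfl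
    · exact ⟨_, h1⟩
    · exact ⟨_, h2⟩
    · exact ⟨_, h2⟩
    · exact ⟨_, h1⟩
  rwa [this] at hl

/-- Triangles of the mesh with a common edge lie on different sides of it, as otherwise they would
overlap near the middle of the edge. -/
lemma outwardNormal_neg {K L : M.Cell} {i j : Fin 3} (hLK : L ≠ K)
    (h : edge L.1 j = edge K.1 i) : outwardNormal L.1 j = -outwardNormal K.1 i := by
  have hK := det_ne_zero K.1
  have hL := det_ne_zero L.1
  -- moving from the middle of the edge towards the vertex of `K`, one leaves `L` immediately
  have hside : bary L.1 j (K.1.points i) ≤ 0 := by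
    by_contra! hpos
    set m := edgeMid K.1 i
    have hmL : m = edgeMid L.1 j := (edgeMid_eq_of_edge_eq h).symm
    let x : ℝ → Plane := fun t => (1 - t) • m + t • K.1.points i
    have hx : Continuous x := by fun_prop
    have hbm : ∀ (T : M.Cell) (a b : Fin 3),
        bary T.1 b (edgeMid T.1 a) = if b = a then 0 else 1 / 2 := by
      intro T a b
      rw [edgeMid_eq, bary_combo _ _ _ _ (by norm_num)]
      fin_cases a <;> fin_cases b <;> simp [bary_self, bary_ne]
    have hev : ∀ᶠ t in nhdsWithin (0 : ℝ) (Ioi 0), ∀ l, 0 ≤ bary L.1 l (x t) := by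
      rw [Filter.eventually_all]
      intro l
      by_cases hl : l = j
      · filter_upwards [Ioo_mem_nhdsGT (zero_lt_one (α := ℝ))] with t ht
        rw [bary_combo _ _ _ _ (by ring), hmL, hbm, if_pos hl, hl]
        rw [mul_zero, zero_add]
        exact mul_nonneg ht.1.le hpos.le
      · have h0 : 0 < bary L.1 l (x 0) := by
          simp only [x, sub_zero, one_smul, zero_smul, add_zero]
          rw [hmL, hbm, if_neg hl]; norm_num
        exact (((((continuous_bary L.1 l).comp hx).tendsto 0).eventually
          (lt_mem_nhds h0)).filter_mono nhdsWithin_le_nhds).mono fun t ht => le_of_lt ht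
    obtain ⟨t, htL, ht⟩ := (hev.and (Ioo_mem_nhdsGT (zero_lt_one (α := ℝ)))).exists
    have htK : ∀ l, bary K.1 l (x t) = (1 - t) * (if l = i then 0 else 1 / 2) +
        t * bary K.1 l (K.1.points i) := by
      intro l
      rw [bary_combo _ _ _ _ (by ring), hbm]
    have hmem : x t ∈ K.1.closedInterior := by
      rw [mem_closedInterior_iff]
      intro l
      rw [htK]
      by_cases hl : l = i
      · rw [hl, bary_self]; simp [ht.1.le]
      · rw [bary_ne _ hl, if_neg hl]; linarith [ht.2]
    have h0 := bary_eq_zero_of_mem_inter (opposite_notMem hLK h) hmem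
      ((mem_closedInterior_iff _ _).2 htL)
    rw [htK, bary_self] at h0
    simp at h0
    exact ht.1.ne' h0
  -- the signed areas on both sides of the oriented edge have opposite signs
  rw [bary] at hside
  rw [outwardNormal_eq, outwardNormal_eq, edgeLength_eq_of_edge_eq h, ← neg_smul, ← neg_div]
  have hKd := det_eq K.1 i
  have horient : ∀ s : ℝ, |s| = 1 → s * det K.1 / det L.1 ≤ 0 →
      s * orient L.1 = - orient K.1 := by
    intro s hs hle
    rw [orient, orient]
    rcases eq_or_eq_neg_of_abs_eq hs with rfl | rfl <;>
      rcases lt_or_gt_of_ne hK with hK' | hK' <;> rcases lt_or_gt_of_ne hL with hL' | hL' <;>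
      simp only [abs_of_neg, abs_of_pos, hK', hL', div_self hK, div_self hL, div_neg, neg_neg,
        one_mul, neg_mul, neg_div] at hle ⊢
    · exact absurd hle (not_le.2 (div_pos_of_neg_of_neg hK' hL'))
    · exact absurd hle (not_le.2 (div_pos hK' hL'))
    · exact absurd hle (not_le.2 (neg_pos.2 (div_neg_of_neg_of_pos hK' hL')))
    · exact absurd hle (not_le.2 (neg_pos.2 (div_neg_of_pos_of_neg hK' hL')))
  rcases endpoints_eq_of_segment_eq h with ⟨h1, h2⟩ | ⟨h1, h2⟩
  · rw [h1, h2, ← hKd] at hside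
    rw [h1, h2, ← horient 1 (by simp) (by simpa using hside), one_mul]
  · rw [h1, h2] at hside
    have e : cross (K.1.points (i + 2) - K.1.points i) (K.1.points (i + 1) - K.1.points i) =
      -det K.1 := by rw [hKd]; simp [cross]; ring
    rw [e] at hside
    rw [h1, h2, ← horient (-1) (by simp) (by simpa using hside)]
    refine plane_ext ?_ ?_ <;> simp [rot] <;> ring

/-- An edge has at most one triangle on its other side. -/
lemma nbrs_subsingleton (K : M.Cell) (i : Fin 3) {L L' : M.Cell} (h : L ∈ M.nbrs K i)
    (h' : L' ∈ M.nbrs K i) : L = L' := by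
  obtain ⟨hL, j, hj⟩ := mem_nbrs.1 h
  obtain ⟨hL', j', hj'⟩ := mem_nbrs.1 h'
  by_contra hne
  have e1 := outwardNormal_neg hL hj
  have e2 := outwardNormal_neg hL' hj'
  have e3 := outwardNormal_neg hne (hj.trans hj'.symm)
  rw [e1, e2, neg_neg] at e3
  have h0 : outwardNormal K.1 i = 0 := by
    have : (2 : ℝ) • outwardNormal K.1 i = 0 := by rw [two_smul]; nth_rewrite 1 [← e3]; simp
    simpa using this
  have := norm_outwardNormal K.1 i
  rw [h0] at this; simp at this

lemma nbrs_eq_empty_or_singleton (K : M.Cell) (i : Fin 3) :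
    M.nbrs K i = ∅ ∨ ∃ L, M.nbrs K i = {L} := by
  rcases (M.nbrs K i).eq_empty_or_nonempty with h | ⟨L, hL⟩
  · exact Or.inl h
  · exact Or.inr ⟨L, Finset.eq_singleton_iff_unique_mem.2
      ⟨hL, fun L' hL' => nbrs_subsingleton K i hL' hL⟩⟩

/-- Sums over the pairs (triangle, interior edge) may be reindexed by exchanging the two
triangles next to the edge. -/
lemma sum_nbrs_swap {E : Type*} [AddCommMonoid E] (F G : M.Cell → Fin 3 → M.Cell → E)
    (h : ∀ K i L j, L ≠ K → edge L.1 j = edge K.1 i → F K i L = G L j K) :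
    ∑ K, ∑ i, ∑ L ∈ M.nbrs K i, F K i L = ∑ K, ∑ i, ∑ L ∈ M.nbrs K i, G K i L := by
  classical
  have key : ∀ H : M.Cell → Fin 3 → M.Cell → E, ∑ K, ∑ i, ∑ L ∈ M.nbrs K i, H K i L =
      ∑ K, ∑ L, ∑ i, ∑ j, if L ≠ K ∧ edge L.1 j = edge K.1 i then H K i L else 0 := by
    intro H
    refine Finset.sum_congr rfl fun K _ => ?_
    rw [Finset.sum_comm (s := Finset.univ) (t := Finset.univ)]
    refine Finset.sum_congr rfl fun i _ => ?_
    rw [nbrs, Finset.sum_filter]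
    refine Finset.sum_congr rfl fun L _ => ?_
    by_cases hL : L ≠ K ∧ ∃ j, edge L.1 j = edge K.1 i
    · obtain ⟨hne, j, hj⟩ := hL
      rw [if_pos ⟨hne, j, hj⟩, Finset.sum_eq_single j, if_pos ⟨hne, hj⟩]
      · intro j' _ hj'
        exact if_neg fun h => hj' (edge_injective _ (h.2.trans hj.symm))
      · simp
    · rw [if_neg hL]
      refine (Finset.sum_eq_zero fun j _ => if_neg fun h => hL ⟨h.1, j, h.2⟩).symm
  rw [key F, key G, Finset.sum_comm]
  refine Finset.sum_congr rfl fun L _ => Finset.sum_congr rfl fun K _ => ?_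
  rw [Finset.sum_comm]
  refine Finset.sum_congr rfl fun j _ => Finset.sum_congr rfl fun i _ => ?_
  by_cases hc : L ≠ K ∧ edge L.1 j = edge K.1 i
  · rw [if_pos hc, if_pos ⟨hc.1.symm, hc.2.symm⟩, h K i L j hc.1 hc.2]
  · rw [if_neg hc, if_neg fun h => hc ⟨h.1.symm, h.2.symm⟩]

end TriMesh

/-! ### The Fourier transform of step functions of time -/

/-- On `L¹ ∩ L²` the Fourier integral represents the `L²` Fourier transform: both are determined
by their pairings with Schwartz functions. -/
lemma fourier_toLp_ae_eq {f : ℝ → ℂ} (h1 : Integrable f) (h2 : MemLp f 2) :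
    𝓕 f =ᵐ[volume] (𝓕 (h2.toLp f) : Lp ℂ 2 (volume : Measure ℝ)) := by
  have hcont : Continuous (𝓕 f) :=
    VectorFourier.fourierIntegral_continuous Real.continuous_fourierChar
      (by exact continuous_inner) h1
  refine ae_eq_of_integral_contDiff_smul_eq hcont.locallyIntegrable
    ((Lp.memLp _).locallyIntegrable one_le_two) fun g hg hgc => ?_
  set G : SchwartzMap ℝ ℂ := (hgc.comp_left Complex.ofReal_zero).toSchwartzMap
    (Complex.ofRealCLM.contDiff.comp hg) with hG
  have hGg : ∀ x, G x = (g x : ℂ) := fun x => rfl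
  have e1 := congrArg (fun T => T G) (Lp.fourier_toTemperedDistribution_eq (h2.toLp f))
  simp only [TemperedDistribution.fourier_apply, Lp.toTemperedDistribution_apply] at e1
  have e2 : ∫ x, (𝓕 G) x • (h2.toLp f) x = ∫ x, (𝓕 G) x • f x := by
    refine integral_congr_ae ?_
    filter_upwards [h2.coeFn_toLp] with x hx
    rw [hx]
  rw [e2] at e1
  have e3 : ∫ x, 𝓕 (G : ℝ → ℂ) x • f x = ∫ x, G x • 𝓕 f x := by
    simpa using! VectorFourier.integral_fourierIntegral_smul_eq_flip (L := innerₗ ℝ)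
      Real.continuous_fourierChar continuous_inner (G.integrable (μ := volume)) h1
  simp only [hGg, Complex.real_smul, smul_eq_mul] at e1 e3 ⊢
  rw [← e1, ← e3]
  rfl

/-- **Plancherel's formula** on `L¹ ∩ L²`. -/
lemma lintegral_fourier_sq {f : ℝ → ℂ} (h1 : Integrable f) (h2 : MemLp f 2) :
    ∫⁻ τ, ‖𝓕 f τ‖ₑ ^ 2 = ∫⁻ t, ‖f t‖ₑ ^ 2 := by
  have key : eLpNorm (𝓕 f) 2 volume = eLpNorm f 2 volume := by
    rw [eLpNorm_congr_ae (fourier_toLp_ae_eq h1 h2), ← Lp.enorm_def,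
      ← eLpNorm_congr_ae h2.coeFn_toLp,
      ← Lp.enorm_def, ← ofReal_norm, ← ofReal_norm, Lp.norm_fourier_eq]
  have hs : ∀ g : ℝ → ℂ, eLpNorm g 2 volume ^ 2 = ∫⁻ t, ‖g t‖ₑ ^ 2 := by
    intro g
    rw [eLpNorm_eq_lintegral_rpow_enorm_toReal two_ne_zero ENNReal.ofNat_ne_top,
      ← ENNReal.rpow_natCast, ← ENNReal.rpow_mul]
    simp
  rw [← hs, ← hs, key]

/-- The step function equal to `w (n + 1)` on `(t_n, t_{n+1}] ∩ (0,T)`, `t_n = n T / N`, and to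
zero outside `(0,T)`. -/
noncomputable def stepFun (T : ℝ) (N : ℕ) (w : ℕ → ℂ) : ℝ → ℂ :=
  indicator (Ioo 0 T) fun t => w ⌈t / (T / N)⌉₊

lemma ceil_div_eq {k t : ℝ} (hk : 0 < k) {n : ℕ} (ht : t ∈ Ioc (n * k) ((n + 1) * k)) :
    ⌈t / k⌉₊ = n + 1 := by
  rw [Nat.ceil_eq_iff n.succ_ne_zero]
  simp only [Nat.succ_eq_add_one, add_tsub_cancel_right, Nat.cast_add, Nat.cast_one]
  exact ⟨(lt_div_iff₀ hk).2 ht.1, (div_le_iff₀ hk).2 ht.2⟩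

/-- The integral over `(0,T)` of an integrand that depends on the number of the time step. -/
lemma integral_steps {E : Type*} [NormedAddCommGroup E] [NormedSpace ℝ E] {T : ℝ} (hT : 0 < T)
    {N : ℕ} (hN : 1 ≤ N) (Φ : ℕ → ℝ → E) (hΦ : ∀ m, Continuous (Φ m)) :
    ∫ t, indicator (Ioo 0 T) (fun t => Φ ⌈t / (T / N)⌉₊ t) t =
      ∑ n ∈ Finset.range N, ∫ t in (n * (T / N))..((n + 1) * (T / N)), Φ (n + 1) t := by
  have hN' : (0 : ℝ) < N := by exact_mod_cast hN
  set k := T / N with hk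
  have hkpos : 0 < k := by positivity
  have hle : ∀ n : ℕ, (n : ℝ) * k ≤ (n + 1) * k := fun n => by nlinarith
  have heq : ∀ n : ℕ, EqOn (fun t => Φ ⌈t / k⌉₊ t) (Φ (n + 1)) (Ioc (n * k) ((n + 1) * k)) :=
    fun n t ht => by simp only [ceil_div_eq hkpos ht]
  rw [integral_indicator measurableSet_Ioo, ← integral_Ioc_eq_integral_Ioo,
    ← intervalIntegral.integral_of_le hT.le]
  have h := intervalIntegral.sum_integral_adjacent_intervals (μ := volume)
    (f := fun t => Φ ⌈t / k⌉₊ t) (a := fun n : ℕ => (n : ℝ) * k) (n := N) (fun n _ => by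
      push_cast
      refine ((hΦ (n + 1)).intervalIntegrable _ _).congr ?_
      rw [uIoc_of_le (hle n)]
      exact (heq n).symm)
  have hTk : (N : ℝ) * k = T := by rw [hk]; field_simp
  simp only [Nat.cast_zero, zero_mul, hTk] at h
  rw [← h]
  refine Finset.sum_congr rfl fun n _ => ?_
  push_cast
  refine intervalIntegral.integral_congr_ae (Filter.Eventually.of_forall fun t ht => ?_)
  rw [uIoc_of_le (hle n)] at ht
  exact heq n ht

lemma memLp_stepFun (T : ℝ) (N : ℕ) (hT : 0 < T) (hN : 1 ≤ N) (w : ℕ → ℂ) (p : ℝ≥0∞) :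
    MemLp (stepFun T N w) p := by
  have hN' : (0 : ℝ) < N := by exact_mod_cast hN
  rw [stepFun, memLp_indicator_iff_restrict measurableSet_Ioo]
  have : IsFiniteMeasure (volume.restrict (Ioo 0 T)) := ⟨by simp⟩
  refine MemLp.of_bound ?_ (∑ m ∈ Finset.range (N + 1), ‖w m‖) ?_
  · exact ((measurable_from_nat (f := w)).comp
      (Nat.measurable_ceil.comp (measurable_id.div_const _))).aestronglyMeasurable
  · filter_upwards [ae_restrict_mem measurableSet_Ioo] with t ht
    refine Finset.single_le_sum (f := fun m => ‖w m‖) (fun _ _ => norm_nonneg _) ?_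
    rw [Finset.mem_range, Nat.lt_succ_iff, Nat.ceil_le, div_le_iff₀ (by positivity)]
    have : (N : ℝ) * (T / N) = T := by field_simp
    rw [this]; exact ht.2.le

/-- Plancherel's formula for step functions. -/
lemma lintegral_fourier_stepFun_sq {T : ℝ} (hT : 0 < T) {N : ℕ} (hN : 1 ≤ N) (w : ℕ → ℂ) :
    ∫⁻ τ, ‖𝓕 (stepFun T N w) τ‖ₑ ^ 2 =
      ENNReal.ofReal (T / N * ∑ n ∈ Finset.range N, ‖w (n + 1)‖ ^ 2) := by
  have h2 := memLp_stepFun T N hT hN w 2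
  rw [lintegral_fourier_sq (memLp_one_iff_integrable.1 (memLp_stepFun T N hT hN w 1)) h2]
  have hsq : ∀ t, ‖stepFun T N w t‖ₑ ^ 2 = ENNReal.ofReal (‖stepFun T N w t‖ ^ 2) := fun t => by
    rw [← ofReal_norm, ENNReal.ofReal_pow (norm_nonneg _)]
  simp only [hsq]
  rw [← ofReal_integral_eq_lintegral_ofReal ((memLp_two_iff_integrable_sq_norm h2.1).1 h2)
    (Filter.Eventually.of_forall fun t => by positivity)]
  congr 1
  have : (fun t => ‖stepFun T N w t‖ ^ 2) =
      indicator (Ioo 0 T) (fun t => (fun (m : ℕ) (_ : ℝ) => ‖w m‖ ^ 2) ⌈t / (T / N)⌉₊ t) := by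
    ext t
    by_cases ht : t ∈ Ioo 0 T <;> simp [stepFun, ht]
  rw [this, integral_steps hT hN (fun (m : ℕ) (_ : ℝ) => ‖w m‖ ^ 2)
    (fun m => continuous_const), Finset.mul_sum]
  refine Finset.sum_congr rfl fun n _ => ?_
  rw [intervalIntegral.integral_const, smul_eq_mul]
  ring

/-- Summation by parts: the Fourier transform of a step function in terms of its jumps. -/
lemma fourier_stepFun {T : ℝ} (hT : 0 < T) {N : ℕ} (hN : 1 ≤ N) (w : ℕ → ℂ) (τ : ℝ) :
    2 * Real.pi * Complex.I * τ * 𝓕 (stepFun T N w) τ =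
      w 0 - Complex.exp (-2 * Real.pi * Complex.I * τ * T) * w N +
        ∑ n ∈ Finset.range N, Complex.exp (-2 * Real.pi * Complex.I * τ * (n * (T / N))) *
          (w (n + 1) - w n) := by
  have hN' : (N : ℂ) ≠ 0 := by exact_mod_cast (by omega : N ≠ 0)
  set c : ℂ := -2 * Real.pi * Complex.I * τ with hc
  have h1 : 𝓕 (stepFun T N w) τ = ∫ t, indicator (Ioo 0 T)
      (fun t => (fun (m : ℕ) (t : ℝ) => Complex.exp (c * t) * w m) ⌈t / (T / N)⌉₊ t) t := by
    rw [Real.fourier_eq']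
    refine integral_congr_ae (Filter.Eventually.of_forall fun t => ?_)
    by_cases ht : t ∈ Ioo 0 T
    · simp only [stepFun, ht, indicator_of_mem, smul_eq_mul, hc]
      congr 2
      simp
      ring
    · simp [stepFun, ht]
  rw [h1, integral_steps hT hN (fun (m : ℕ) (t : ℝ) => Complex.exp (c * t) * w m)
    (fun m => by fun_prop), Finset.mul_sum]
  set e : ℕ → ℂ := fun n => Complex.exp (c * (n * (T / N))) with he
  have h2 : ∀ n : ℕ, -c * ∫ t in ((n : ℝ) * (T / N))..((n + 1) * (T / N)),
      Complex.exp (c * t) * w (n + 1) = (e n - e (n + 1)) * w (n + 1) := by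
    intro n
    rw [intervalIntegral.integral_mul_const, ← mul_assoc]
    congr 1
    by_cases h0 : c = 0
    · simp [h0, he]
    · rw [integral_exp_mul_complex h0]
      simp only [he]
      push_cast
      field_simp
      ring
  have hcc : 2 * Real.pi * Complex.I * τ = -c := by rw [hc]; ring
  rw [hcc, Finset.sum_congr rfl fun n _ => h2 n]
  have hNT : (N : ℂ) * (T / N) = T := by field_simp
  have key : ∀ m : ℕ, ∑ n ∈ Finset.range m, (e n - e (n + 1)) * w (n + 1) =
      w 0 - e m * w m + ∑ n ∈ Finset.range m, e n * (w (n + 1) - w n) := by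
    intro m
    induction m with
    | zero => simp [he]
    | succ m ih => rw [Finset.sum_range_succ, Finset.sum_range_succ, ih]; ring
  rw [key N]
  simp only [he, hNT]

namespace TriMesh

variable {Ω : Set Plane} {M : TriMesh Ω}

/-! ### Discrete norms and the discrete operators -/

variable (M) in
/-- The transmissivity `τ_σ = |σ| / d_σ` of the `i`-th edge of `K`, an edge shared with `L`. -/
noncomputable def transmissivity (K : M.Cell) (i : Fin 3) (L : M.Cell) : ℝ :=
  edgeLength K.1 i / dist K.1.circumcenter L.1.circumcenter

/-- The squared `L²` norm of a piecewise constant function. -/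
noncomputable def sqL2 {E : Type*} [NormedAddCommGroup E] (q : M.Cell → E) : ℝ :=
  ∑ K, area K.1 * ‖q K‖ ^ 2

/-- The squared discrete `H¹` seminorm `∑_σ τ_σ |q_K - q_L|²`; every interior edge is met twice in
the sum below. -/
noncomputable def sqH1 {E : Type*} [NormedAddCommGroup E] (q : M.Cell → E) : ℝ :=
  1 / 2 * ∑ K, ∑ i, ∑ L ∈ M.nbrs K i, M.transmissivity K i L * ‖q L - q K‖ ^ 2

/-- The squared discrete `L²` norm `∑_σ |σ| d_σ (v · n_σ)²` of the normal components of `v` on the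
interior edges. -/
noncomputable def sqFlux (v : M.P1dVec) : ℝ :=
  1 / 2 * ∑ K, ∑ i, ∑ L ∈ M.nbrs K i,
    edgeLength K.1 i * dist K.1.circumcenter L.1.circumcenter * normalFlux v K i ^ 2

/-- The fluxes of `v` through the interior edges are conservative and balance on every triangle. -/
structure HasBalancedFlux (v : M.P1dVec) : Prop where
  conservative : ∀ (K : M.Cell) (i : Fin 3) (L : M.Cell) (j : Fin 3), L ≠ K →
    edge L.1 j = edge K.1 i → normalFlux v L j = -normalFlux v K i
  balanced : ∀ K : M.Cell, ∑ i, ∑ _L ∈ M.nbrs K i, edgeLength K.1 i * normalFlux v K i = 0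

lemma transmissivity_nonneg (K : M.Cell) (i : Fin 3) (L : M.Cell) : 0 ≤ M.transmissivity K i L :=
  div_nonneg dist_nonneg dist_nonneg

lemma transmissivity_symm {K L : M.Cell} {i j : Fin 3} (h : edge L.1 j = edge K.1 i) :
    M.transmissivity L j K = M.transmissivity K i L := by
  rw [transmissivity, transmissivity, edgeLength_eq_of_edge_eq h, dist_comm]

lemma sqL2_nonneg {E : Type*} [NormedAddCommGroup E] (q : M.Cell → E) : 0 ≤ sqL2 q :=
  Finset.sum_nonneg fun K _ => mul_nonneg (area_pos K.1).le (sq_nonneg _)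

lemma sqH1_nonneg {E : Type*} [NormedAddCommGroup E] (q : M.Cell → E) : 0 ≤ sqH1 q :=
  mul_nonneg (by norm_num) <| Finset.sum_nonneg fun K _ => Finset.sum_nonneg fun i _ =>
    Finset.sum_nonneg fun L _ => mul_nonneg (transmissivity_nonneg K i L) (sq_nonneg _)

/-- The Cauchy-Schwarz inequality for sums over the sides of the interior edges. -/
lemma sum_nbrs_mul_le (t a b : M.Cell → Fin 3 → M.Cell → ℝ) (ht : ∀ K i L, 0 ≤ t K i L) :
    ∑ K, ∑ i, ∑ L ∈ M.nbrs K i, t K i L * (|a K i L| * |b K i L|) ≤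
      √(∑ K, ∑ i, ∑ L ∈ M.nbrs K i, t K i L * a K i L ^ 2) *
        √(∑ K, ∑ i, ∑ L ∈ M.nbrs K i, t K i L * b K i L ^ 2) := by
  simp only [Finset.sum_sigma']
  refine le_trans (le_of_eq ?_) (Real.sum_sqrt_mul_sqrt_le _ (fun x => ?_) (fun x => ?_))
  · refine Finset.sum_congr rfl fun x _ => ?_
    rw [Real.sqrt_mul (ht _ _ _), Real.sqrt_mul (ht _ _ _), Real.sqrt_sq_eq_abs,
      Real.sqrt_sq_eq_abs, mul_mul_mul_comm, Real.mul_self_sqrt (ht _ _ _)]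
  · exact mul_nonneg (ht _ _ _) (sq_nonneg _)
  · exact mul_nonneg (ht _ _ _) (sq_nonneg _)

/-- If `F` is antisymmetric under exchange of the two sides of an edge, the sum of the `F_{K,σ}`
tested with `r` is a sum of differences of `r`. -/
lemma sum_nbrs_mul_eq (F : M.Cell → Fin 3 → M.Cell → ℝ) (r : M.P0)
    (hF : ∀ K i L j, L ≠ K → edge L.1 j = edge K.1 i → F L j K = -F K i L) :
    ∑ K, (∑ i, ∑ L ∈ M.nbrs K i, F K i L) * r K =
      -(1 / 2 * ∑ K, ∑ i, ∑ L ∈ M.nbrs K i, F K i L * (r L - r K)) := by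
  have h1 : ∑ K, (∑ i, ∑ L ∈ M.nbrs K i, F K i L) * r K =
      ∑ K, ∑ i, ∑ L ∈ M.nbrs K i, F K i L * r K := by
    simp only [Finset.sum_mul]
  have h2 : ∑ K, ∑ i, ∑ L ∈ M.nbrs K i, F K i L * r K =
      ∑ K, ∑ i, ∑ L ∈ M.nbrs K i, -(F K i L * r L) :=
    sum_nbrs_swap _ _ fun K i L j hLK h => by rw [hF K i L j hLK h]; ring
  have h3 : ∑ K, ∑ i, ∑ L ∈ M.nbrs K i, F K i L * (r L - r K) =
      -(∑ K, ∑ i, ∑ L ∈ M.nbrs K i, -(F K i L * r L)) -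
        ∑ K, ∑ i, ∑ L ∈ M.nbrs K i, F K i L * r K := by
    simp only [← Finset.sum_neg_distrib, ← Finset.sum_sub_distrib]
    refine Finset.sum_congr rfl fun K _ => Finset.sum_congr rfl fun i _ =>
      Finset.sum_congr rfl fun L _ => by ring
  rw [h3, h1, ← h2]; ring

lemma area_mul_lapl (q : M.P0) (K : M.Cell) :
    area K.1 * lapl q K = ∑ i, ∑ L ∈ M.nbrs K i, M.transmissivity K i L * (q L - q K) := by
  rw [lapl, mul_inv_cancel_left₀ (area_pos K.1).ne']; rfl

lemma area_mul_upwind (v : M.P1dVec) (q : M.P0) (K : M.Cell) :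
    area K.1 * upwind v q K = ∑ i, ∑ L ∈ M.nbrs K i,
      edgeLength K.1 i * (max (normalFlux v K i) 0 * q K + min (normalFlux v K i) 0 * q L) := by
  rw [upwind, mul_inv_cancel_left₀ (area_pos K.1).ne']

/-- Discrete integration by parts. -/
lemma sum_area_lapl (q r : M.P0) :
    ∑ K, area K.1 * (lapl q K * r K) =
      -(1 / 2 * ∑ K, ∑ i, ∑ L ∈ M.nbrs K i, M.transmissivity K i L * (q L - q K) * (r L - r K)) := by
  simp only [← mul_assoc, area_mul_lapl]
  refine sum_nbrs_mul_eq _ r fun K i L j _ h => ?_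
  rw [transmissivity_symm h]; ring

lemma sum_area_lapl_self (q : M.P0) : ∑ K, area K.1 * (lapl q K * q K) = -sqH1 q := by
  rw [sum_area_lapl, sqH1]
  simp only [mul_assoc, Real.norm_eq_abs, sq_abs]
  simp only [sq]

lemma abs_sum_area_lapl_le (q r : M.P0) :
    |∑ K, area K.1 * (lapl q K * r K)| ≤ √(sqH1 q) * √(sqH1 r) := by
  rw [sum_area_lapl, abs_neg, abs_mul, abs_of_pos (by norm_num : (0 : ℝ) < 1 / 2)]
  have h := sum_nbrs_mul_le M.transmissivity (fun K _ L => q L - q K) (fun K _ L => r L - r K)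
    transmissivity_nonneg
  have h2 : |∑ K, ∑ i, ∑ L ∈ M.nbrs K i, M.transmissivity K i L * (q L - q K) * (r L - r K)| ≤
      ∑ K, ∑ i, ∑ L ∈ M.nbrs K i, M.transmissivity K i L * (|q L - q K| * |r L - r K|) := by
    refine (Finset.abs_sum_le_sum_abs _ _).trans (Finset.sum_le_sum fun K _ => ?_)
    refine (Finset.abs_sum_le_sum_abs _ _).trans (Finset.sum_le_sum fun i _ => ?_)
    refine (Finset.abs_sum_le_sum_abs _ _).trans (Finset.sum_le_sum fun L _ => ?_)
    rw [abs_mul, abs_mul, abs_of_nonneg (transmissivity_nonneg K i L), mul_assoc]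
  simp only [sqH1, Real.norm_eq_abs, sq_abs]
  rw [Real.sqrt_mul (by norm_num), Real.sqrt_mul (by norm_num), mul_mul_mul_comm,
    Real.mul_self_sqrt (by norm_num)]
  exact mul_le_mul_of_nonneg_left (h2.trans h) (by norm_num)

/-- The convection form of a bounded function is controlled by the velocity and the discrete `H¹`
seminorm of the test function. -/
lemma abs_sum_area_upwind_le {v : M.P1dVec} (hv : HasBalancedFlux v) {B : ℝ} (hB : 0 ≤ B)
    (hd : ∀ K i, ∀ L ∈ M.nbrs K i, 0 < dist K.1.circumcenter L.1.circumcenter)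
    (q r : M.P0) (hq : ∀ K, |q K| ≤ B) :
    |∑ K, area K.1 * (upwind v q K * r K)| ≤ B * √(sqFlux v) * √(sqH1 r) := by
  have h1 : ∑ K, area K.1 * (upwind v q K * r K) =
      -(1 / 2 * ∑ K, ∑ i, ∑ L ∈ M.nbrs K i, edgeLength K.1 i *
        (max (normalFlux v K i) 0 * q K + min (normalFlux v K i) 0 * q L) * (r L - r K)) := by
    simp only [← mul_assoc, area_mul_upwind]
    refine sum_nbrs_mul_eq _ r fun K i L j hLK h => ?_
    rw [edgeLength_eq_of_edge_eq h, hv.conservative K i L j hLK h]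
    have e1 : max (-normalFlux v K i) 0 = -min (normalFlux v K i) 0 := by
      rw [← neg_zero, max_neg_neg, neg_zero]
    have e2 : min (-normalFlux v K i) 0 = -max (normalFlux v K i) 0 := by
      rw [← neg_zero, min_neg_neg, neg_zero]
    rw [e1, e2]; ring
  rw [h1, abs_neg, abs_mul, abs_of_pos (by norm_num : (0 : ℝ) < 1 / 2)]
  have h := sum_nbrs_mul_le M.transmissivity
    (fun K i L => dist K.1.circumcenter L.1.circumcenter * normalFlux v K i)
    (fun K _ L => r L - r K) transmissivity_nonneg
  have h2 : |∑ K, ∑ i, ∑ L ∈ M.nbrs K i, edgeLength K.1 i *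
        (max (normalFlux v K i) 0 * q K + min (normalFlux v K i) 0 * q L) * (r L - r K)| ≤
      B * ∑ K, ∑ i, ∑ L ∈ M.nbrs K i, M.transmissivity K i L *
        (|dist K.1.circumcenter L.1.circumcenter * normalFlux v K i| * |r L - r K|) := by
    simp only [Finset.mul_sum]
    refine (Finset.abs_sum_le_sum_abs _ _).trans (Finset.sum_le_sum fun K _ => ?_)
    refine (Finset.abs_sum_le_sum_abs _ _).trans (Finset.sum_le_sum fun i _ => ?_)
    refine (Finset.abs_sum_le_sum_abs _ _).trans (Finset.sum_le_sum fun L hL => ?_)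
    have hdK := hd K i L hL
    have hF : |max (normalFlux v K i) 0 * q K + min (normalFlux v K i) 0 * q L| ≤
        B * |normalFlux v K i| := by
      rcases le_total (normalFlux v K i) 0 with h0 | h0
      · rw [max_eq_right h0, min_eq_left h0, zero_mul, zero_add, abs_mul, mul_comm]
        exact mul_le_mul_of_nonneg_right (hq L) (abs_nonneg _)
      · rw [max_eq_left h0, min_eq_right h0, zero_mul, add_zero, abs_mul, mul_comm]
        exact mul_le_mul_of_nonneg_right (hq K) (abs_nonneg _)
    have he : 0 ≤ edgeLength K.1 i := dist_nonneg
    rw [abs_mul, abs_mul, abs_of_nonneg he, abs_mul, abs_of_pos hdK]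
    calc edgeLength K.1 i * |max (normalFlux v K i) 0 * q K + min (normalFlux v K i) 0 * q L| *
          |r L - r K| ≤ edgeLength K.1 i * (B * |normalFlux v K i|) * |r L - r K| := by gcongr
      _ = _ := by rw [transmissivity]; field_simp
  have h3 : ∑ K, ∑ i, ∑ L ∈ M.nbrs K i, M.transmissivity K i L *
        (dist K.1.circumcenter L.1.circumcenter * normalFlux v K i) ^ 2 =
      ∑ K, ∑ i, ∑ L ∈ M.nbrs K i,
        edgeLength K.1 i * dist K.1.circumcenter L.1.circumcenter * normalFlux v K i ^ 2 := by
    refine Finset.sum_congr rfl fun K _ => Finset.sum_congr rfl fun i _ =>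
      Finset.sum_congr rfl fun L hL => ?_
    have hdK := (hd K i L hL).ne'
    rw [transmissivity]; field_simp
  rw [h3] at h
  simp only [sqH1, sqFlux, Real.norm_eq_abs, sq_abs]
  rw [Real.sqrt_mul (by norm_num), Real.sqrt_mul (by norm_num), mul_assoc, mul_mul_mul_comm,
    Real.mul_self_sqrt (by norm_num), mul_left_comm]
  exact mul_le_mul_of_nonneg_left (h2.trans (mul_le_mul_of_nonneg_left h hB)) (by norm_num)

/-! ### The discrete maximum principle -/

/-- Since the fluxes balance, `q K` may be subtracted from all values of `q`, which leaves the
incoming fluxes only. -/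
lemma upwind_nonneg_of_isMax {v : M.P1dVec} (hv : HasBalancedFlux v) (q : M.P0) (K : M.Cell)
    (hK : ∀ L, q L ≤ q K) : 0 ≤ upwind v q K := by
  have h : area K.1 * upwind v q K = ∑ i, ∑ L ∈ M.nbrs K i,
      edgeLength K.1 i * (min (normalFlux v K i) 0 * (q L - q K)) := by
    rw [area_mul_upwind, ← sub_eq_zero, ← Finset.sum_sub_distrib]
    have := congrArg (· * q K) (hv.balanced K)
    simp only [zero_mul, Finset.sum_mul] at this
    refine Eq.trans ?_ this
    refine Finset.sum_congr rfl fun i _ => ?_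
    rw [← Finset.sum_sub_distrib]
    refine Finset.sum_congr rfl fun L _ => ?_
    linear_combination edgeLength K.1 i * q K * max_add_min (normalFlux v K i) 0
  have h2 : 0 ≤ area K.1 * upwind v q K := by
    rw [h]
    refine Finset.sum_nonneg fun i _ => Finset.sum_nonneg fun L _ => ?_
    exact mul_nonneg dist_nonneg
      (mul_nonneg_of_nonpos_of_nonpos (min_le_right _ _) (sub_nonpos.2 (hK L)))
  exact nonneg_of_mul_nonneg_right h2 (area_pos K.1)

lemma lapl_nonpos_of_isMax (q : M.P0) (K : M.Cell) (hK : ∀ L, q L ≤ q K) : lapl q K ≤ 0 := by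
  have h2 : area K.1 * lapl q K ≤ 0 := by
    rw [area_mul_lapl]
    refine Finset.sum_nonpos fun i _ => Finset.sum_nonpos fun L _ => ?_
    exact mul_nonpos_of_nonneg_of_nonpos (transmissivity_nonneg K i L) (sub_nonpos.2 (hK L))
  exact nonpos_of_mul_nonpos_right h2 (area_pos K.1)

lemma upwind_neg (v : M.P1dVec) (q : M.P0) (K : M.Cell) :
    upwind v (fun L => -q L) K = -upwind v q K := by
  rw [upwind, upwind, ← mul_neg, ← Finset.sum_neg_distrib]
  congr 1
  refine Finset.sum_congr rfl fun i _ => ?_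
  rw [← Finset.sum_neg_distrib]
  exact Finset.sum_congr rfl fun L _ => by ring

lemma lapl_neg (q : M.P0) (K : M.Cell) : lapl (fun L => -q L) K = -lapl q K := by
  rw [lapl, lapl, ← mul_neg, ← Finset.sum_neg_distrib]
  congr 1
  refine Finset.sum_congr rfl fun i _ => ?_
  rw [← Finset.sum_neg_distrib]
  exact Finset.sum_congr rfl fun L _ => by ring

/-- One step of the implicit scheme for `∂_t q - D Δ q + div (q v) = g - ℓ q`. -/
def IsStep (k D ℓ : ℝ) (g : M.P0) (v : M.P1dVec) (q q' : M.P0) : Prop :=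
  ∀ K, (q' K - q K) / k - D * lapl q' K = g K - ℓ * q' K - upwind v q' K

/-- An upper bound is preserved by the scheme. -/
lemma IsStep.le {k D ℓ : ℝ} (hk : 0 < k) (hD : 0 ≤ D) (hl : 0 ≤ ℓ) {g : M.P0} {v : M.P1dVec}
    (hv : HasBalancedFlux v) {q q' : M.P0} (h : IsStep k D ℓ g v q q') {b : ℝ}
    (hg : ∀ K, g K ≤ ℓ * b) (hq : ∀ K, q K ≤ b) (K : M.Cell) : q' K ≤ b := by
  have : Nonempty M.Cell := ⟨K⟩
  obtain ⟨J, hJ⟩ := Finite.exists_max q'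
  refine (hJ K).trans ?_
  by_contra! hb
  have h1 := h J
  have h2 := upwind_nonneg_of_isMax hv q' J hJ
  have h3 := mul_nonpos_of_nonneg_of_nonpos hD (lapl_nonpos_of_isMax q' J hJ)
  have h4 : 0 < (q' J - q J) / k := div_pos (by linarith [hq J]) hk
  have h5 := mul_le_mul_of_nonneg_left hb.le hl
  linarith [hg J]

/-- A lower bound is preserved by the scheme. -/
lemma IsStep.ge {k D ℓ : ℝ} (hk : 0 < k) (hD : 0 ≤ D) (hl : 0 ≤ ℓ) {g : M.P0} {v : M.P1dVec}
    (hv : HasBalancedFlux v) {q q' : M.P0} (h : IsStep k D ℓ g v q q') {a : ℝ}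
    (hg : ∀ K, ℓ * a ≤ g K) (hq : ∀ K, a ≤ q K) (K : M.Cell) : a ≤ q' K := by
  have h' : IsStep k D ℓ (fun L => -g L) v (fun L => -q L) (fun L => -q' L) := by
    intro J
    rw [lapl_neg, upwind_neg]
    linear_combination -(h J)
  have := h'.le hk hD hl hv (b := -a) (fun J => by linarith [hg J]) (fun J => by linarith [hq J]) K
  linarith

/-! ### Energy estimates -/

lemma abs_sum_area_mul_le {A R : ℝ} (hA : ∑ K : M.Cell, area K.1 ≤ A) (hR : 0 ≤ R) (g r : M.P0)
    (hg : ∀ K, |g K| ≤ R) : |∑ K, area K.1 * (g K * r K)| ≤ R * √A * √(sqL2 r) := by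
  have h1 : |∑ K, area K.1 * (g K * r K)| ≤ ∑ K, R * (√(area K.1) * √(area K.1 * r K ^ 2)) := by
    refine (Finset.abs_sum_le_sum_abs _ _).trans (Finset.sum_le_sum fun K _ => ?_)
    have ha := (area_pos K.1).le
    have e : √(area K.1) * √(area K.1 * r K ^ 2) = area K.1 * |r K| := by
      rw [Real.sqrt_mul ha, Real.sqrt_sq_eq_abs, ← mul_assoc, Real.mul_self_sqrt ha]
    rw [e, abs_mul, abs_mul, abs_of_nonneg ha, mul_left_comm]
    exact mul_le_mul_of_nonneg_right (hg K) (mul_nonneg ha (abs_nonneg _))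
  have h2 : ∑ K, √(area K.1) * √(area K.1 * r K ^ 2) ≤
      √(∑ K : M.Cell, area K.1) * √(∑ K, area K.1 * r K ^ 2) :=
    Real.sum_sqrt_mul_sqrt_le _ (fun K => (area_pos K.1).le)
      (fun K => mul_nonneg (area_pos K.1).le (sq_nonneg _))
  have h3 : sqL2 r = ∑ K, area K.1 * r K ^ 2 := by
    simp only [sqL2, Real.norm_eq_abs, sq_abs]
  rw [← Finset.mul_sum] at h1
  rw [h3, mul_assoc]
  refine h1.trans (mul_le_mul_of_nonneg_left (h2.trans ?_) hR)
  exact mul_le_mul_of_nonneg_right (Real.sqrt_le_sqrt hA) (Real.sqrt_nonneg _)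

lemma sqL2_le {A B : ℝ} (hA : ∑ K : M.Cell, area K.1 ≤ A) (q : M.P0)
    (hq : ∀ K, |q K| ≤ B) : sqL2 q ≤ A * B ^ 2 := by
  rw [sqL2]
  refine le_trans ?_ (mul_le_mul_of_nonneg_right hA (sq_nonneg B))
  rw [Finset.sum_mul]
  refine Finset.sum_le_sum fun K _ => mul_le_mul_of_nonneg_left ?_ (area_pos K.1).le
  rw [Real.norm_eq_abs]
  exact pow_le_pow_left₀ (abs_nonneg _) (hq K) 2

/-- Bounds shared by all the steps of a discrete evolution `w 0, …, w N` governed by `IsStep`. -/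
structure IsBoundedEvolution (k D ℓ B R U A : ℝ) (N : ℕ) (g : M.P0) (v : ℕ → M.P1dVec)
    (w : ℕ → M.P0) : Prop where
  step : ∀ n < N, IsStep k D ℓ g (v n) (w n) (w (n + 1))
  balanced : ∀ n < N, HasBalancedFlux (v n)
  dist_pos : ∀ K i, ∀ L ∈ M.nbrs K i, 0 < dist K.1.circumcenter L.1.circumcenter
  bound : ∀ n ≤ N, ∀ K, |w n K| ≤ B
  reaction : ∀ n < N, ∀ K, |g K - ℓ * w (n + 1) K| ≤ R
  flux : ∀ n < N, sqFlux (v n) ≤ U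
  area_le : ∑ K : M.Cell, area K.1 ≤ A

variable {k D ℓ B R U A : ℝ} {N : ℕ} {g : M.P0} {v : ℕ → M.P1dVec} {w : ℕ → M.P0}

/-- The discrete time derivative as a sum of its diffusion, reaction and convection parts. -/
lemma IsBoundedEvolution.sum_area_eq (h : IsBoundedEvolution k D ℓ B R U A N g v w) {n : ℕ}
    (hn : n < N) (r : M.P0) :
    ∑ K, area K.1 * ((w (n + 1) K - w n K) / k * r K) =
      D * ∑ K, area K.1 * (lapl (w (n + 1)) K * r K) +
        ∑ K, area K.1 * ((g K - ℓ * w (n + 1) K) * r K) -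
        ∑ K, area K.1 * (upwind (v n) (w (n + 1)) K * r K) := by
  rw [Finset.mul_sum, ← Finset.sum_add_distrib, ← Finset.sum_sub_distrib]
  refine Finset.sum_congr rfl fun K _ => ?_
  linear_combination area K.1 * r K * h.step n hn K

/-- The discrete time derivative, as a functional on the discrete `H¹` space. -/
lemma IsBoundedEvolution.abs_sum_area_le (h : IsBoundedEvolution k D ℓ B R U A N g v w)
    (hD : 0 ≤ D) (hB : 0 ≤ B) (hR : 0 ≤ R) {n : ℕ} (hn : n < N) (r : M.P0) :
    |∑ K, area K.1 * ((w (n + 1) K - w n K) / k * r K)| ≤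
      (D * √(sqH1 (w (n + 1))) + B * √U) * √(sqH1 r) + R * √A * √(sqL2 r) := by
  rw [h.sum_area_eq hn r]
  have h1 := abs_sum_area_lapl_le (w (n + 1)) r
  have h2 := abs_sum_area_mul_le h.area_le hR (fun K => g K - ℓ * w (n + 1) K) r
    (h.reaction n hn)
  have h3 := abs_sum_area_upwind_le (h.balanced n hn) hB h.dist_pos (w (n + 1)) r
    (h.bound (n + 1) hn)
  have h4 : B * √(sqFlux (v n)) * √(sqH1 r) ≤ B * √U * √(sqH1 r) := by
    have := h.flux n hn
    gcongr
  refine (abs_sub _ _).trans ?_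
  have h5 := abs_add_le (D * ∑ K, area K.1 * (lapl (w (n + 1)) K * r K))
    (∑ K, area K.1 * ((g K - ℓ * w (n + 1) K) * r K))
  rw [abs_mul D, abs_of_nonneg hD] at h5
  nlinarith [mul_le_mul_of_nonneg_left h1 hD]

/-- The energy estimate in the discrete `L²(0,T; H¹)` norm. -/
lemma IsBoundedEvolution.sum_sqH1_le (h : IsBoundedEvolution k D ℓ B R U A N g v w)
    (hk : 0 < k) (hD : 0 < D) (hB : 0 ≤ B) (hR : 0 ≤ R) (hU : 0 ≤ U) (hA : 0 ≤ A) :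
    k * ∑ n ∈ Finset.range N, sqH1 (w (n + 1)) ≤
      2 / D * (A * B ^ 2 / 2 + k * N * (R * A * B + B ^ 2 * U / (2 * D))) := by
  have hstep : ∀ n ∈ Finset.range N, k * sqH1 (w (n + 1)) ≤
      2 / D * ((sqL2 (w n) / 2 - sqL2 (w (n + 1)) / 2) +
        k * (R * A * B + B ^ 2 * U / (2 * D))) := by
    intro n hn
    rw [Finset.mem_range] at hn
    have e := h.sum_area_eq hn (w (n + 1))
    rw [sum_area_lapl_self] at e
    have h2 := abs_sum_area_mul_le h.area_le hR (fun K => g K - ℓ * w (n + 1) K) (w (n + 1))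
      (h.reaction n hn)
    have h3 := abs_sum_area_upwind_le (h.balanced n hn) hB h.dist_pos (w (n + 1)) (w (n + 1))
      (h.bound (n + 1) hn)
    have h4 : B * √(sqFlux (v n)) * √(sqH1 (w (n + 1))) ≤ B * √U * √(sqH1 (w (n + 1))) := by
      have := h.flux n hn
      gcongr
    have h5 : R * √A * √(sqL2 (w (n + 1))) ≤ R * A * B := by
      have := Real.sqrt_le_sqrt (sqL2_le h.area_le (w (n + 1)) (h.bound (n + 1) hn))
      rw [Real.sqrt_mul hA, Real.sqrt_sq hB] at this
      calc R * √A * √(sqL2 (w (n + 1))) ≤ R * √A * (√A * B) := by gcongr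
        _ = R * (√A * √A) * B := by ring
        _ = _ := by rw [Real.mul_self_sqrt hA]
    have h6 : (sqL2 (w (n + 1)) / 2 - sqL2 (w n) / 2) / k ≤
        ∑ K, area K.1 * ((w (n + 1) K - w n K) / k * w (n + 1) K) := by
      rw [sqL2, sqL2, Finset.sum_div, Finset.sum_div, ← Finset.sum_sub_distrib, Finset.sum_div]
      refine Finset.sum_le_sum fun K _ => ?_
      rw [div_mul_eq_mul_div, ← mul_div_assoc]
      refine div_le_div_of_nonneg_right ?_ hk.le
      simp only [Real.norm_eq_abs, sq_abs]
      nlinarith [mul_nonneg (area_pos K.1).le (sq_nonneg (w (n + 1) K - w n K))]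
    -- the convection term is absorbed by one half of the diffusion term
    have h7 : B * √U * √(sqH1 (w (n + 1))) ≤
        D / 2 * sqH1 (w (n + 1)) + B ^ 2 * U / (2 * D) := by
      have s1 := Real.mul_self_sqrt hU
      have s2 := Real.mul_self_sqrt (sqH1_nonneg (w (n + 1)))
      have : D / 2 * sqH1 (w (n + 1)) + B ^ 2 * U / (2 * D) - B * √U * √(sqH1 (w (n + 1))) =
          (D * √(sqH1 (w (n + 1))) - B * √U) ^ 2 / (2 * D) := by
        rw [eq_div_iff (by positivity)]
        field_simp
        linear_combination -(D ^ 2) * s2 - B ^ 2 * s1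
      have h0 : 0 ≤ (D * √(sqH1 (w (n + 1))) - B * √U) ^ 2 / (2 * D) := by positivity
      linarith
    have h8 := neg_abs_le (∑ K, area K.1 * (upwind (v n) (w (n + 1)) K * w (n + 1) K))
    have h9 := le_abs_self (∑ K, area K.1 * ((g K - ℓ * w (n + 1) K) * w (n + 1) K))
    have h10 : (sqL2 (w (n + 1)) / 2 - sqL2 (w n) / 2) / k ≤
        -(D / 2 * sqH1 (w (n + 1))) + (R * A * B + B ^ 2 * U / (2 * D)) := by linarith
    rw [div_le_iff₀ hk] at h10
    rw [div_mul_eq_mul_div, le_div_iff₀ hD]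
    linarith
  rw [Finset.mul_sum]
  refine (Finset.sum_le_sum hstep).trans ?_
  rw [← Finset.mul_sum, Finset.sum_add_distrib, Finset.sum_range_sub' (fun n => sqL2 (w n) / 2),
    Finset.sum_const, Finset.card_range, nsmul_eq_mul]
  have h0 := sqL2_le h.area_le (w 0) (h.bound 0 (Nat.zero_le _))
  have hN := sqL2_nonneg (w N)
  refine mul_le_mul_of_nonneg_left ?_ (by positivity)
  linarith

/-! ### The Fourier transform of a discrete evolution -/

/-- A real functional bounded on real functions extends with twice its bound to complex ones. -/
lemma norm_sum_area_mul_le (z : M.P0) {a b : ℝ} (ha : 0 ≤ a) (hb : 0 ≤ b)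
    (h : ∀ r : M.P0, |∑ K, area K.1 * (z K * r K)| ≤ a * √(sqH1 r) + b * √(sqL2 r))
    (q : M.Cell → ℂ) :
    ‖∑ K, (area K.1 : ℂ) * (z K * q K)‖ ≤ 2 * (a * √(sqH1 q) + b * √(sqL2 q)) := by
  have hre : (∑ K, (area K.1 : ℂ) * (z K * q K)).re = ∑ K, area K.1 * (z K * (q K).re) := by
    simp [Complex.re_sum]
  have him : (∑ K, (area K.1 : ℂ) * (z K * q K)).im = ∑ K, area K.1 * (z K * (q K).im) := by
    simp [Complex.im_sum]
  have key : ∀ r : M.P0, (∀ K, |r K| ≤ ‖q K‖) → (∀ K L, |r L - r K| ≤ ‖q L - q K‖) →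
      |∑ K, area K.1 * (z K * r K)| ≤ a * √(sqH1 q) + b * √(sqL2 q) := by
    intro r h0 h1
    refine (h r).trans ?_
    have e0 : sqL2 r ≤ sqL2 q := by
      refine Finset.sum_le_sum fun K _ => mul_le_mul_of_nonneg_left ?_ (area_pos K.1).le
      exact pow_le_pow_left₀ (norm_nonneg _) (h0 K) 2
    have e1 : sqH1 r ≤ sqH1 q := by
      refine mul_le_mul_of_nonneg_left ?_ (by norm_num)
      refine Finset.sum_le_sum fun K _ => Finset.sum_le_sum fun i _ =>
        Finset.sum_le_sum fun L _ => mul_le_mul_of_nonneg_left ?_ (transmissivity_nonneg K i L)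
      exact pow_le_pow_left₀ (norm_nonneg _) (h1 K L) 2
    gcongr
  refine (Complex.norm_le_abs_re_add_abs_im _).trans ?_
  rw [hre, him, two_mul]
  refine add_le_add (key _ (fun K => Complex.abs_re_le_norm _) fun K L => ?_)
    (key _ (fun K => Complex.abs_im_le_norm _) fun K L => ?_)
  · rw [← Complex.sub_re]; exact Complex.abs_re_le_norm _
  · rw [← Complex.sub_im]; exact Complex.abs_im_le_norm _

/-- The Fourier transform in time of the values on the triangles of the step function
`w (n + 1)` on `(t_n, t_{n+1}]`. -/
noncomputable def stepFourier (T : ℝ) (N : ℕ) (w : ℕ → M.P0) (τ : ℝ) : M.Cell → ℂ :=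
  fun K => 𝓕 (stepFun T N fun n => (w n K : ℂ)) τ

lemma continuous_fourier_stepFun {T : ℝ} (hT : 0 < T) (hN : 1 ≤ N) (W : ℕ → ℂ) :
    Continuous (𝓕 (stepFun T N W)) :=
  VectorFourier.fourierIntegral_continuous Real.continuous_fourierChar
    (by exact continuous_inner) (memLp_one_iff_integrable.1 (memLp_stepFun T N hT hN W 1))

lemma fourier_stepFun_sub {T : ℝ} (hT : 0 < T) (hN : 1 ≤ N) (W W' : ℕ → ℂ) (τ : ℝ) :
    𝓕 (stepFun T N W) τ - 𝓕 (stepFun T N W') τ = 𝓕 (stepFun T N fun n => W n - W' n) τ := by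
  have h : stepFun T N W = (stepFun T N fun n => W n - W' n) + stepFun T N W' := by
    ext t
    by_cases ht : t ∈ Ioo 0 T <;> simp [stepFun, ht]
  have e := VectorFourier.fourierIntegral_add (L := innerₗ ℝ) (μ := volume)
    Real.continuous_fourierChar (by exact continuous_inner)
    (memLp_one_iff_integrable.1 (memLp_stepFun T N hT hN (fun n => W n - W' n) 1))
    (memLp_one_iff_integrable.1 (memLp_stepFun T N hT hN W' 1))
  rw [← h] at e
  rw [sub_eq_iff_eq_add]
  exact congrFun e τ

/-- Plancherel's formula for weighted sums of squares of step functions. -/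
lemma lintegral_sum_fourier_stepFun {ι : Type*} {T : ℝ} (hT : 0 < T) (hN : 1 ≤ N) (s : Finset ι)
    (a : ι → ℝ) (ha : ∀ i ∈ s, 0 ≤ a i) (W : ι → ℕ → ℂ) :
    ∫⁻ τ, ENNReal.ofReal (∑ i ∈ s, a i * ‖𝓕 (stepFun T N (W i)) τ‖ ^ 2) =
      ENNReal.ofReal (T / N * ∑ n ∈ Finset.range N, ∑ i ∈ s, a i * ‖W i (n + 1)‖ ^ 2) := by
  have h1 : ∀ τ, ENNReal.ofReal (∑ i ∈ s, a i * ‖𝓕 (stepFun T N (W i)) τ‖ ^ 2) =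
      ∑ i ∈ s, ENNReal.ofReal (a i) * ‖𝓕 (stepFun T N (W i)) τ‖ₑ ^ 2 := by
    intro τ
    rw [ENNReal.ofReal_sum_of_nonneg fun i hi => mul_nonneg (ha i hi) (sq_nonneg _)]
    refine Finset.sum_congr rfl fun i hi => ?_
    rw [ENNReal.ofReal_mul (ha i hi), ENNReal.ofReal_pow (norm_nonneg _), ofReal_norm]
  have hm : ∀ i, Measurable fun τ => ‖𝓕 (stepFun T N (W i)) τ‖ₑ ^ 2 := fun i =>
    (continuous_fourier_stepFun hT hN (W i)).measurable.enorm.pow_const 2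
  simp only [h1]
  rw [lintegral_finsetSum _ fun i _ => (hm i).const_mul _, Finset.sum_comm, Finset.mul_sum,
    ENNReal.ofReal_sum_of_nonneg fun i hi => by
      have := ha i hi
      positivity]
  refine Finset.sum_congr rfl fun i hi => ?_
  rw [lintegral_const_mul _ (hm i), lintegral_fourier_stepFun_sq hT hN,
    ← ENNReal.ofReal_mul (ha i hi), ← Finset.mul_sum, mul_left_comm]

lemma lintegral_sqL2_stepFourier {T : ℝ} (hT : 0 < T) (hN : 1 ≤ N) (w : ℕ → M.P0) :
    ∫⁻ τ, ENNReal.ofReal (sqL2 (stepFourier T N w τ)) =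
      ENNReal.ofReal (T / N * ∑ n ∈ Finset.range N, sqL2 (w (n + 1))) := by
  have := lintegral_sum_fourier_stepFun hT hN Finset.univ (fun K : M.Cell => area K.1)
    (fun K _ => (area_pos K.1).le) (fun K n => (w n K : ℂ))
  simpa only [sqL2, stepFourier, Complex.norm_real] using this

lemma lintegral_sqH1_stepFourier {T : ℝ} (hT : 0 < T) (hN : 1 ≤ N) (w : ℕ → M.P0) :
    ∫⁻ τ, ENNReal.ofReal (sqH1 (stepFourier T N w τ)) =
      ENNReal.ofReal (T / N * ∑ n ∈ Finset.range N, sqH1 (w (n + 1))) := by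
  have := lintegral_sum_fourier_stepFun hT hN
    ((Finset.univ : Finset M.Cell).sigma fun K => (Finset.univ : Finset (Fin 3)).sigma
      fun i => M.nbrs K i)
    (fun x => 1 / 2 * M.transmissivity x.1 x.2.1 x.2.2)
    (fun x _ => mul_nonneg (by norm_num) (transmissivity_nonneg _ _ _))
    (fun x n => (w n x.2.2 : ℂ) - (w n x.1 : ℂ))
  simp only [Finset.sum_sigma, ← Complex.ofReal_sub,
    Complex.norm_real, mul_assoc, ← Finset.mul_sum] at this
  simpa only [sqH1, stepFourier, fourier_stepFun_sub hT hN, ← Complex.ofReal_sub, mul_assoc,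
    ← Finset.mul_sum] using this

/-- The equation controls `|τ| |ŵ(τ)|²`: its Fourier transform in time is tested with the conjugate
of `ŵ(τ)`. -/
lemma IsBoundedEvolution.abs_mul_sqL2_le {T : ℝ} (hT : 0 < T) (hN : 1 ≤ N)
    (h : IsBoundedEvolution (T / N) D ℓ B R U A N g v w)
    (hD : 0 ≤ D) (hB : 0 ≤ B) (hR : 0 ≤ R) {E : ℝ}
    (hE : T / N * ∑ n ∈ Finset.range N, sqH1 (w (n + 1)) ≤ E) (τ : ℝ) :
    |τ| * sqL2 (stepFourier T N w τ) ≤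
      (D * (T + E) + T * (B * √U + R * √A) + 2 * B * √A) *
        (√(sqH1 (stepFourier T N w τ)) + √(sqL2 (stepFourier T N w τ))) := by
  have hN' : (0 : ℝ) < N := by exact_mod_cast hN
  set k := T / N with hk
  have hkpos : 0 < k := by positivity
  have hkN : k * N = T := by rw [hk]; field_simp
  set W := stepFourier T N w τ with hW
  set x := √(sqH1 W)
  set y := √(sqL2 W)
  have hx : 0 ≤ x := Real.sqrt_nonneg _
  have hy : 0 ≤ y := Real.sqrt_nonneg _
  have hconj : (sqH1 fun K => starRingEnd ℂ (W K)) = sqH1 W ∧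
      (sqL2 fun K => starRingEnd ℂ (W K)) = sqL2 W := by
    simp only [sqH1, sqL2, ← map_sub, RCLike.norm_conj, and_self]
  set q : M.Cell → ℂ := fun K => starRingEnd ℂ (W K) with hq
  have hsq : ((sqL2 W : ℝ) : ℂ) = ∑ K, (area K.1 : ℂ) * (W K * q K) := by
    rw [sqL2]
    push_cast
    refine Finset.sum_congr rfl fun K _ => ?_
    rw [hq, Complex.mul_conj, Complex.normSq_eq_norm_sq]; push_cast; rfl
  set e : ℕ → ℂ := fun n => Complex.exp (-2 * Real.pi * Complex.I * τ * (n * (T / N)))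
  have hexp : ∀ s : ℝ, ‖Complex.exp (-2 * Real.pi * Complex.I * τ * s)‖ = 1 := by
    intro s
    have : -2 * Real.pi * Complex.I * τ * s = ((-2 * Real.pi * τ * s : ℝ) : ℂ) * Complex.I := by
      push_cast; ring
    rw [this, Complex.norm_exp_ofReal_mul_I]
  have he : ∀ n, ‖e n‖ = 1 := fun n => by
    have := hexp (n * (T / N))
    push_cast at this
    exact this
  -- the summation by parts in time, tested with `q`
  have hid : 2 * Real.pi * Complex.I * τ * (sqL2 W : ℝ) =
      ∑ K, (area K.1 : ℂ) * (w 0 K * q K) -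
        Complex.exp (-2 * Real.pi * Complex.I * τ * T) * ∑ K, (area K.1 : ℂ) * (w N K * q K) +
        ∑ n ∈ Finset.range N, e n * k *
          ∑ K, (area K.1 : ℂ) * (((w (n + 1) K - w n K) / k : ℝ) * q K) := by
    rw [hsq]
    simp only [Finset.mul_sum]
    rw [Finset.sum_comm (s := Finset.range N), ← Finset.sum_sub_distrib, ← Finset.sum_add_distrib]
    refine Finset.sum_congr rfl fun K _ => ?_
    have hf := fourier_stepFun hT hN (fun n => (w n K : ℂ)) τ
    have hWK : W K = 𝓕 (stepFun T N fun n => (w n K : ℂ)) τ := rfl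
    rw [← hWK] at hf
    have hkc : (k : ℂ) ≠ 0 := by exact_mod_cast hkpos.ne'
    have : ∀ n ∈ Finset.range N, e n * k * ((area K.1 : ℂ) *
        (((w (n + 1) K - w n K) / k : ℝ) * q K)) =
        area K.1 * q K * (e n * ((w (n + 1) K : ℂ) - w n K)) := by
      intro n _
      push_cast
      field_simp
    rw [Finset.sum_congr rfl this, ← Finset.mul_sum]
    linear_combination (area K.1 : ℂ) * q K * hf
  -- the jumps at the times `0` and `T` are bounded in `L²`
  have hw : ∀ n ≤ N, ‖∑ K, (area K.1 : ℂ) * (w n K * q K)‖ ≤ 2 * (B * √A * y) := by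
    intro n hn
    have := norm_sum_area_mul_le (w n) (a := 0) (b := B * √A) le_rfl (by positivity)
      (fun r => by
        simpa using abs_sum_area_mul_le h.area_le hB (w n) r (h.bound n hn)) q
    rwa [hconj.2, zero_mul, zero_add] at this
  -- the jumps between the steps are controlled by the scheme
  have hz : ∀ n ∈ Finset.range N, ‖e n * k *
      ∑ K, (area K.1 : ℂ) * (((w (n + 1) K - w n K) / k : ℝ) * q K)‖ ≤
      k * (2 * ((D * √(sqH1 (w (n + 1))) + B * √U) * x + R * √A * y)) := by
    intro n hn
    have := norm_sum_area_mul_le (fun K => (w (n + 1) K - w n K) / k)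
      (a := D * √(sqH1 (w (n + 1))) + B * √U) (b := R * √A) (by positivity) (by positivity)
      (h.abs_sum_area_le hD hB hR (Finset.mem_range.1 hn)) q
    rw [hconj.1, hconj.2] at this
    rw [norm_mul, norm_mul, he, one_mul, Complex.norm_of_nonneg hkpos.le]
    exact mul_le_mul_of_nonneg_left this hkpos.le
  have hsum : ∑ n ∈ Finset.range N, k * (2 * ((D * √(sqH1 (w (n + 1))) + B * √U) * x +
      R * √A * y)) ≤ (D * (T + E) + 2 * T * (B * √U)) * x + 2 * T * (R * √A) * y := by
    have h1 : ∀ n ∈ Finset.range N, k * (2 * ((D * √(sqH1 (w (n + 1))) + B * √U) * x +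
        R * √A * y)) ≤ k * sqH1 (w (n + 1)) * (D * x) +
          k * ((D + 2 * (B * √U)) * x + 2 * (R * √A) * y) := by
      intro n _
      have s1 := Real.sq_sqrt (sqH1_nonneg (w (n + 1)))
      have : 2 * √(sqH1 (w (n + 1))) ≤ 1 + sqH1 (w (n + 1)) := by
        nlinarith [sq_nonneg (√(sqH1 (w (n + 1))) - 1)]
      have := mul_le_mul_of_nonneg_left this (by positivity : 0 ≤ k * (D * x))
      linarith
    refine (Finset.sum_le_sum h1).trans ?_
    rw [Finset.sum_add_distrib, ← Finset.sum_mul, ← Finset.mul_sum, Finset.sum_const,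
      Finset.card_range, nsmul_eq_mul]
    have hc : (N : ℝ) * (k * ((D + 2 * (B * √U)) * x + 2 * (R * √A) * y)) =
        T * ((D + 2 * (B * √U)) * x + 2 * (R * √A) * y) := by rw [← hkN]; ring
    have := mul_le_mul_of_nonneg_right hE (by positivity : 0 ≤ D * x)
    linarith
  have hnorm := congrArg norm hid
  have hl : ‖2 * Real.pi * Complex.I * τ * (sqL2 W : ℝ)‖ = 2 * Real.pi * (|τ| * sqL2 W) := by
    simp only [norm_mul, Complex.norm_I, Complex.norm_real, Real.norm_eq_abs,
      abs_of_pos Real.pi_pos, abs_of_nonneg (sqL2_nonneg W), Complex.norm_ofNat]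
    ring
  rw [hl] at hnorm
  have htot : 2 * Real.pi * (|τ| * sqL2 W) ≤ 4 * (B * √A * y) +
      ((D * (T + E) + 2 * T * (B * √U)) * x + 2 * T * (R * √A) * y) := by
    rw [hnorm]
    refine (norm_add_le _ _).trans ?_
    refine (add_le_add (norm_sub_le _ _) ((norm_sum_le _ _).trans
      ((Finset.sum_le_sum hz).trans hsum))).trans ?_
    rw [norm_mul, hexp, one_mul]
    linarith [hw 0 (Nat.zero_le _), hw N le_rfl]
  have hpi : 2 * (|τ| * sqL2 W) ≤ 2 * Real.pi * (|τ| * sqL2 W) := by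
    have : 0 ≤ |τ| * sqL2 W := mul_nonneg (abs_nonneg _) (sqL2_nonneg W)
    nlinarith [Real.pi_gt_three]
  have hE0 : 0 ≤ E := le_trans (mul_nonneg hkpos.le
    (Finset.sum_nonneg fun n _ => sqH1_nonneg _)) hE
  have p1 : 0 ≤ B * √A * x := by positivity
  have p2 : 0 ≤ D * (T + E) * x := by positivity
  have p3 : 0 ≤ D * (T + E) * y := by positivity
  have p4 : 0 ≤ T * (B * √U) * y := by positivity
  have p5 : 0 ≤ T * (R * √A) * x := by positivity
  linarith

end TriMesh

/-! ### Fractional time regularity -/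

/-- For `|τ| ≤ 1` the term `F` alone is enough; for `|τ| ≥ 1` Young's inequality applies to the
products of `|τ| ^ (2 * γ - 1)` with `√G` and `√F`. -/
lemma rpow_mul_le {γ : ℝ} (hγ₀ : 0 < γ) (hγ₁ : γ < 1 / 4) {C F G τ : ℝ} (hC : 0 ≤ C) (hF : 0 ≤ F)
    (hG : 0 ≤ G) (h : |τ| * F ≤ C * (√G + √F)) :
    |τ| ^ (2 * γ) * F ≤
      (C + 1) * (2 ^ (2 - 4 * γ) * (1 + |τ|) ^ (-(2 - 4 * γ)) + F + G) := by
  have hJ : 0 ≤ 2 ^ (2 - 4 * γ) * (1 + |τ|) ^ (-(2 - 4 * γ)) := by positivity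
  rcases le_or_gt |τ| 1 with h1 | h1
  · have : |τ| ^ (2 * γ) ≤ 1 := Real.rpow_le_one (abs_nonneg _) h1 (by linarith)
    have h2 : |τ| ^ (2 * γ) * F ≤ 1 * F := mul_le_mul_of_nonneg_right this hF
    nlinarith [mul_nonneg hC hJ, mul_nonneg hC hF, mul_nonneg hC hG]
  · have hτ : 0 < |τ| := by linarith
    set p := |τ| ^ (2 * γ - 1) with hp
    have hp0 : 0 ≤ p := by positivity
    have e1 : |τ| ^ (2 * γ) = p * |τ| := by
      rw [hp, ← Real.rpow_add_one hτ.ne']; congr 1; ring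
    have e2 : p ^ 2 ≤ 2 ^ (2 - 4 * γ) * (1 + |τ|) ^ (-(2 - 4 * γ)) := by
      have : p ^ 2 = |τ| ^ (-(2 - 4 * γ)) := by
        rw [hp, ← Real.rpow_natCast, ← Real.rpow_mul hτ.le]; congr 1; push_cast; ring
      rw [this]
      calc |τ| ^ (-(2 - 4 * γ)) ≤ ((1 + |τ|) / 2) ^ (-(2 - 4 * γ)) :=
            Real.rpow_le_rpow_of_nonpos (by linarith) (by linarith) (by linarith)
        _ = _ := by
          rw [Real.div_rpow (by linarith) (by norm_num), Real.rpow_neg (by norm_num : (0 : ℝ) ≤ 2),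
            div_inv_eq_mul, mul_comm]
    have h2 := mul_le_mul_of_nonneg_left h hp0
    have s1 := Real.sq_sqrt hF
    have s2 := Real.sq_sqrt hG
    have h3 : p * (√G + √F) ≤ p ^ 2 + F + G := by
      nlinarith [sq_nonneg (p - √G), sq_nonneg (p - √F), sq_nonneg √G, sq_nonneg √F]
    have h4 := mul_le_mul_of_nonneg_left h3 hC
    have h5 : C * (p ^ 2 + F + G) ≤ C * (2 ^ (2 - 4 * γ) * (1 + |τ|) ^ (-(2 - 4 * γ)) + F + G) :=
      mul_le_mul_of_nonneg_left (by linarith) hC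
    rw [e1]
    nlinarith

/-- The weight `|τ|^{2γ}` is absorbed, for `γ < 1/4`, by the control of `|τ| |ŵ(τ)|²`: here
`F τ = |ŵ(τ)|²`, and `G τ` is the square of the discrete `H¹` seminorm of `ŵ(τ)`. -/
lemma lintegral_rpow_mul_le {γ : ℝ} (hγ₀ : 0 < γ) (hγ₁ : γ < 1 / 4) {C : ℝ} (hC : 0 ≤ C)
    {F G : ℝ → ℝ} (hF : ∀ τ, 0 ≤ F τ) (hG : ∀ τ, 0 ≤ G τ)
    (h : ∀ τ, |τ| * F τ ≤ C * (√(G τ) + √(F τ))) (hFm : Measurable F) :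
    ∫⁻ τ, ENNReal.ofReal (|τ| ^ (2 * γ)) * ENNReal.ofReal (F τ) ≤
      ENNReal.ofReal (C + 1) * (ENNReal.ofReal (2 ^ (2 - 4 * γ)) *
        ENNReal.ofReal (∫ τ : ℝ, (1 + |τ|) ^ (-(2 - 4 * γ))) +
          (∫⁻ τ, ENNReal.ofReal (F τ)) + ∫⁻ τ, ENNReal.ofReal (G τ)) := by
  have hint : Integrable fun τ : ℝ => (1 + |τ|) ^ (-(2 - 4 * γ)) := by
    have := integrable_one_add_norm (E := ℝ) (μ := volume) (r := 2 - 4 * γ)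
      (by simp; linarith)
    simpa only [Real.norm_eq_abs] using this
  have hm : Measurable fun τ : ℝ => ENNReal.ofReal ((1 + |τ|) ^ (-(2 - 4 * γ))) := by
    fun_prop
  rw [ofReal_integral_eq_lintegral_ofReal hint (Filter.Eventually.of_forall fun τ => by positivity),
    ← lintegral_const_mul _ hm, ← lintegral_add_left (hm.const_mul _),
    ← lintegral_add_left (by fun_prop), ← lintegral_const_mul' _ _ ENNReal.ofReal_ne_top]
  refine lintegral_mono fun τ => ?_
  have hJ : 0 ≤ 2 ^ (2 - 4 * γ) * (1 + |τ|) ^ (-(2 - 4 * γ)) := by positivity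
  rw [← ENNReal.ofReal_mul (by positivity), ← ENNReal.ofReal_mul (by positivity),
    ← ENNReal.ofReal_add hJ (hF τ), ← ENNReal.ofReal_add (add_nonneg hJ (hF τ)) (hG τ),
    ← ENNReal.ofReal_mul (by positivity)]
  exact ENNReal.ofReal_le_ofReal (rpow_mul_le hγ₀ hγ₁ hC (hF τ) (hG τ) (h τ))

namespace TriMesh

variable {Ω : Set Plane} {M : TriMesh Ω}

lemma measurable_sqL2_stepFourier {T : ℝ} (hT : 0 < T) {N : ℕ}
    (hN : 1 ≤ N) (w : ℕ → M.P0) : Measurable fun τ => sqL2 (stepFourier T N w τ) := by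
  have : Continuous fun τ => sqL2 (stepFourier T N w τ) := by
    unfold sqL2 stepFourier
    have := fun K : M.Cell => continuous_fourier_stepFun hT hN fun n => (w n K : ℂ)
    fun_prop
  exact this.measurable

/-- Fractional regularity in time of bounded evolutions, with a bound that does not depend on the
mesh nor on the number of time steps. -/
lemma IsBoundedEvolution.exists_lintegral_le (Ω : Set Plane) {γ : ℝ} (hγ₀ : 0 < γ)
    (hγ₁ : γ < 1 / 4) {T D ℓ B R U A : ℝ} (hT : 0 < T) (hD : 0 < D) (hB : 0 ≤ B) (hR : 0 ≤ R)
    (hU : 0 ≤ U) (hA : 0 ≤ A) :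
    ∃ C : ℝ≥0, ∀ (M : TriMesh Ω) (N : ℕ), 1 ≤ N → ∀ (g : M.P0) (v : ℕ → M.P1dVec) (w : ℕ → M.P0),
      IsBoundedEvolution (T / N) D ℓ B R U A N g v w →
        ∫⁻ τ, ENNReal.ofReal (|τ| ^ (2 * γ)) * ENNReal.ofReal (sqL2 (stepFourier T N w τ)) ≤ C := by
  set E := 2 / D * (A * B ^ 2 / 2 + T * (R * A * B + B ^ 2 * U / (2 * D))) with hE
  have hE0 : 0 ≤ E := by positivity
  set C₁ := D * (T + E) + T * (B * √U + R * √A) + 2 * B * √A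
  have hC₁ : 0 ≤ C₁ := by positivity
  set C := ENNReal.ofReal (C₁ + 1) * (ENNReal.ofReal (2 ^ (2 - 4 * γ)) *
    ENNReal.ofReal (∫ τ : ℝ, (1 + |τ|) ^ (-(2 - 4 * γ))) +
      ENNReal.ofReal (T * (A * B ^ 2)) + ENNReal.ofReal E) with hC
  have hCt : C ≠ ⊤ := by
    rw [hC]
    exact ENNReal.mul_ne_top ENNReal.ofReal_ne_top (ENNReal.add_ne_top.2
      ⟨ENNReal.add_ne_top.2 ⟨ENNReal.mul_ne_top ENNReal.ofReal_ne_top ENNReal.ofReal_ne_top,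
        ENNReal.ofReal_ne_top⟩, ENNReal.ofReal_ne_top⟩)
  refine ⟨C.toNNReal, fun M N hN g v w h => ?_⟩
  rw [ENNReal.coe_toNNReal hCt]
  have hN' : (0 : ℝ) < N := by exact_mod_cast hN
  have hkpos : 0 < T / N := by positivity
  have hkN : T / N * N = T := by field_simp
  have hH := h.sum_sqH1_le hkpos hD hB hR hU hA
  rw [hkN] at hH
  have hL : T / N * ∑ n ∈ Finset.range N, sqL2 (w (n + 1)) ≤ T * (A * B ^ 2) := by
    have : ∑ n ∈ Finset.range N, sqL2 (w (n + 1)) ≤ ∑ n ∈ Finset.range N, A * B ^ 2 :=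
      Finset.sum_le_sum fun n hn => sqL2_le h.area_le _ (h.bound (n + 1) (Finset.mem_range.1 hn))
    rw [Finset.sum_const, Finset.card_range, nsmul_eq_mul] at this
    calc _ ≤ T / N * (N * (A * B ^ 2)) := mul_le_mul_of_nonneg_left this hkpos.le
      _ = _ := by rw [← mul_assoc, hkN]
  refine (lintegral_rpow_mul_le hγ₀ hγ₁ hC₁ (fun τ => sqL2_nonneg _) (fun τ => sqH1_nonneg _)
    (h.abs_mul_sqL2_le hT hN hD.le hB hR hH) (measurable_sqL2_stepFourier hT hN w)).trans ?_
  rw [lintegral_sqL2_stepFourier hT hN, lintegral_sqH1_stepFourier hT hN, hC]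
  gcongr

/-! ### The discrete Darcy law -/

/-- Sums over the interior edges of a quantity which changes sign with the side vanish. -/
lemma sum_nbrs_eq_zero (F : M.Cell → Fin 3 → M.Cell → ℝ)
    (hF : ∀ K i L j, L ≠ K → edge L.1 j = edge K.1 i → F L j K = -F K i L) :
    ∑ K, ∑ i, ∑ L ∈ M.nbrs K i, F K i L = 0 := by
  have h := sum_nbrs_swap F (fun K i L => -F K i L) fun K i L j hLK h => by
    rw [hF K i L j hLK h, neg_neg]
  simp only [Finset.sum_neg_distrib] at h
  linarith

/-- A piecewise constant field with continuous normal components, which vanish on the boundary. -/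
structure IsConstRT0 (y : M.P0Vec) : Prop where
  interior : ∀ (K : M.Cell) (i : Fin 3), ∀ L ∈ M.nbrs K i,
    inner ℝ (y L) (outwardNormal K.1 i) = inner ℝ (y K) (outwardNormal K.1 i)
  exterior : ∀ (K : M.Cell) (i : Fin 3), M.nbrs K i = ∅ → inner ℝ (y K) (outwardNormal K.1 i) = 0

lemma IsConstRT0.sum_nbrs {y : M.P0Vec} (hy : IsConstRT0 y) (K : M.Cell) (i : Fin 3) (a : ℝ) :
    ∑ _L ∈ M.nbrs K i, a * inner ℝ (y K) (outwardNormal K.1 i) =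
      a * inner ℝ (y K) (outwardNormal K.1 i) := by
  rcases nbrs_eq_empty_or_singleton K i with h | ⟨L, h⟩
  · rw [h, hy.exterior K i h]; simp
  · rw [h, Finset.sum_singleton]

lemma IsConstRT0.neg_of_edge_eq {y : M.P0Vec} (hy : IsConstRT0 y) {K L : M.Cell} {i j : Fin 3}
    (hLK : L ≠ K) (h : edge L.1 j = edge K.1 i) :
    inner ℝ (y L) (outwardNormal L.1 j) = -inner ℝ (y K) (outwardNormal K.1 i) := by
  rw [outwardNormal_neg hLK h, inner_neg_right, hy.interior K i L (mem_nbrs.2 ⟨hLK, j, h⟩)]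

/-- Discrete Helmholtz orthogonality: such fields are orthogonal to the gradients of `P_1^{nc}`. -/
lemma IsConstRT0.sum_area_inner_gradh {y : M.P0Vec} (hy : IsConstRT0 y) {p : M.P1d}
    (hp : IsP1nc p) : ∑ K, area K.1 * inner ℝ (y K) (gradh p K) = 0 := by
  have h := sum_nbrs_eq_zero (M := M) (fun K i _ => edgeLength K.1 i * p K (edgeMid K.1 i) *
    inner ℝ (y K) (outwardNormal K.1 i)) (by
      intro K i L j hLK h
      have e := hp K i L (mem_nbrs.2 ⟨hLK, j, h⟩)
      rw [hy.neg_of_edge_eq hLK h, edgeLength_eq_of_edge_eq h, edgeMid_eq_of_edge_eq h, ← e]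
      ring)
  rw [← h]
  refine Finset.sum_congr rfl fun K _ => ?_
  rw [area_eq, gradh, ← sum_edgeLength_edgeMid_inner]
  exact Finset.sum_congr rfl fun i _ => (hy.sum_nbrs K i _).symm

lemma continuous_affine {F : Type*} [NormedAddCommGroup F] [NormedSpace ℝ F] (p : Plane →ᵃ[ℝ] F) :
    Continuous p := p.continuous_of_finiteDimensional

/-- A piecewise constant field with continuous normal components is its own projection. -/
lemma IsProjRT0.eq_of_isConstRT0 {y : M.P0Vec} (hy : IsConstRT0 y) {u : M.P1dVec}
    (hu : IsProjRT0 y u) (K : M.Cell) {x : Plane} (hx : x ∈ K.1.closedInterior) :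
    u K x = y K := by
  set v : M.P1dVec := fun K => u K - AffineMap.const ℝ Plane (y K) with hv
  have hvx : ∀ K x, v K x = u K x - y K := fun K x => rfl
  have hvRT : IsRT0 v := by
    refine ⟨fun K i x hx z hz => ?_, fun K i L hL x hx => ?_, fun K i h x hx => ?_⟩
    · rw [hvx, hvx, inner_sub_left, inner_sub_left, hu.1.const K i x hx z hz]
    · rw [hvx, hvx, inner_sub_left, inner_sub_left, hu.1.interior K i L hL x hx,
        hy.interior K i L hL]
    · rw [hvx, inner_sub_left, hu.1.exterior K i h x hx, hy.exterior K i h, sub_zero]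
  have hcv : ∀ K, Continuous (v K) := fun K => continuous_affine _
  have hcu : ∀ K, Continuous (u K) := fun K => continuous_affine _
  have hint : ∀ (K : M.Cell) (g : Plane → ℝ), Continuous g → IntegrableOn g K.1.closedInterior :=
    fun K g hg => hg.continuousOn.integrableOn_compact K.1.isCompact_closedInterior
  have h0 : ∑ K : M.Cell, ∫ x in K.1.closedInterior, ‖v K x‖ ^ 2 = 0 := by
    have h := hu.2 v hvRT
    rw [← sub_eq_zero, ← Finset.sum_sub_distrib] at h
    rw [← h]
    refine Finset.sum_congr rfl fun K _ => ?_
    rw [← integral_sub]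
    · refine integral_congr_ae (Filter.Eventually.of_forall fun x => ?_)
      simp only
      rw [← inner_sub_left, ← hvx, real_inner_self_eq_norm_sq]
    · exact hint K _ ((hcu K).inner (hcv K))
    · exact hint K _ (continuous_const.inner (hcv K))
  have h1 := (Finset.sum_eq_zero_iff_of_nonneg fun K _ =>
    integral_nonneg fun x => sq_nonneg ‖v K x‖).1 h0 K (Finset.mem_univ K)
  have h2 := eqOn_zero_of_setIntegral_eq_zero K.1 ((hcv K).norm.pow 2)
    (fun x => sq_nonneg _) h1 hx
  have h3 : v K x = 0 := by simpa using h2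
  rwa [hvx, sub_eq_zero] at h3

lemma IsProjRT0.normalFlux_eq {y : M.P0Vec} (hy : IsConstRT0 y) {u : M.P1dVec}
    (hu : IsProjRT0 y u) (K : M.Cell) (i : Fin 3) :
    normalFlux u K i = inner ℝ (y K) (outwardNormal K.1 i) := by
  rw [normalFlux, hu.eq_of_isConstRT0 hy K (edgeMid_mem K.1 i)]

lemma IsProjRT0.hasBalancedFlux {y : M.P0Vec} (hy : IsConstRT0 y) {u : M.P1dVec}
    (hu : IsProjRT0 y u) : HasBalancedFlux u := by
  refine ⟨fun K i L j hLK h => ?_, fun K => ?_⟩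
  · rw [hu.normalFlux_eq hy, hu.normalFlux_eq hy, hy.neg_of_edge_eq hLK h]
  · rw [← sum_edgeLength_inner_outwardNormal K.1 (y K)]
    refine Finset.sum_congr rfl fun i _ => ?_
    rw [hu.normalFlux_eq hy, hy.sum_nbrs]

/-! ### The pressure equation and the source -/

/-- The values at the middles of the edges of the projection of the source on `P_1^{nc}` are jumps
of the flux. -/
lemma area_mul_edgeMid_eq {a b r : M.P1d} {z f : M.P0Vec} (ha : IsDivh z a) (hb : IsDivh f b)
    (h : a = b - r) (K : M.Cell) (i : Fin 3) :
    area K.1 / 3 * r K (edgeMid K.1 i) + edgeLength K.1 i *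
        inner ℝ (f K - z K) (outwardNormal K.1 i) =
      ∑ L ∈ M.nbrs K i, edgeLength K.1 i / (area K.1 + area L.1) *
        (area K.1 * inner ℝ (f L - z L) (outwardNormal K.1 i) +
          area L.1 * inner ℝ (f K - z K) (outwardNormal K.1 i)) := by
  have hr : r K (edgeMid K.1 i) = b K (edgeMid K.1 i) - a K (edgeMid K.1 i) := by
    rw [h]; simp
  have hK := area_pos K.1
  rw [hr]
  rcases nbrs_eq_empty_or_singleton K i with h0 | ⟨L, h0⟩
  · rw [(ha.2 K i).2 h0, (hb.2 K i).2 h0, h0, Finset.sum_empty, inner_sub_left]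
    field_simp; ring
  · have hL := area_pos L.1
    have hmem : L ∈ M.nbrs K i := by rw [h0]; simp
    rw [(ha.2 K i).1 L hmem, (hb.2 K i).1 L hmem, h0, Finset.sum_singleton]
    simp only [inner_sub_left]
    field_simp; ring

/-- The source of a solvable discrete pressure equation has zero mean: test with `1`. -/
lemma sum_area_source_eq_zero {a b r : M.P1d} {z f : M.P0Vec} {s : M.P0} (ha : IsDivh z a)
    (hb : IsDivh f b) (h : a = b - r) (hr : IsProjP1nc s r) : ∑ K, area K.1 * s K = 0 := by
  have h1 := hr.2 (fun _ => AffineMap.const ℝ Plane 1) (fun K i L _ => rfl)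
  simp only [AffineMap.const_apply, mul_one, setIntegral_const, smul_eq_mul] at h1
  have h2 : ∀ K : M.Cell, ∫ x in K.1.closedInterior, r K x = ∑ i, ∑ L ∈ M.nbrs K i,
      edgeLength K.1 i / (area K.1 + area L.1) *
        (area K.1 * inner ℝ (f L - z L) (outwardNormal K.1 i) +
          area L.1 * inner ℝ (f K - z K) (outwardNormal K.1 i)) := by
    intro K
    rw [Finset.sum_congr rfl fun i _ => (area_mul_edgeMid_eq ha hb h K i).symm,
      Finset.sum_add_distrib, sum_edgeLength_inner_outwardNormal, add_zero, ← Finset.mul_sum,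
      setIntegral_affine]
  have h3 := sum_nbrs_eq_zero (M := M) (fun K i L =>
      edgeLength K.1 i / (area K.1 + area L.1) *
        (area K.1 * inner ℝ (f L - z L) (outwardNormal K.1 i) +
          area L.1 * inner ℝ (f K - z K) (outwardNormal K.1 i))) (by
    intro K i L j hLK h
    rw [outwardNormal_neg hLK h, edgeLength_eq_of_edge_eq h, inner_neg_right, inner_neg_right,
      add_comm (area L.1)]
    ring)
  rw [← h3]
  simp only [h2] at h1
  rw [h1]
  rfl

/-- Without source the flux `f - z` has continuous normal components. -/
lemma isConstRT0_of_source_eq_zero {a b r : M.P1d} {z f : M.P0Vec} {s : M.P0} (ha : IsDivh z a)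
    (hb : IsDivh f b) (h : a = b - r) (hr : IsProjP1nc s r) (hs : ∀ K, s K = 0) :
    IsConstRT0 fun K => f K - z K := by
  have hr0 : ∀ K i, r K (edgeMid K.1 i) = 0 := by
    intro K i
    have h1 := hr.2 r hr.1
    simp only [hs, zero_mul, integral_zero, Finset.sum_const_zero, ← sq] at h1
    have h2 := (Finset.sum_eq_zero_iff_of_nonneg fun K _ =>
      integral_nonneg fun x => sq_nonneg (r K x)).1 h1 K (Finset.mem_univ K)
    have h3 := eqOn_zero_of_setIntegral_eq_zero K.1 ((continuous_affine (r K)).pow 2)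
      (fun x => sq_nonneg _) h2 (edgeMid_mem K.1 i)
    simpa using h3
  have key := fun K i => area_mul_edgeMid_eq ha hb h K i
  refine ⟨fun K i L hL => ?_, fun K i h0 => ?_⟩
  · obtain h0 | ⟨L', h0⟩ := nbrs_eq_empty_or_singleton K i
    · rw [h0] at hL; simp at hL
    · have := key K i
      rw [h0] at hL this
      rw [Finset.mem_singleton] at hL
      subst hL
      rw [hr0, Finset.sum_singleton, mul_zero, zero_add] at this
      have hK := area_pos K.1
      have hL := area_pos L.1
      have hl := edgeLength_pos K.1 i
      have h5 : edgeLength K.1 i * inner ℝ (f K - z K) (outwardNormal K.1 i) *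
          (area K.1 + area L.1) = edgeLength K.1 i *
        (area K.1 * inner ℝ (f L - z L) (outwardNormal K.1 i) +
          area L.1 * inner ℝ (f K - z K) (outwardNormal K.1 i)) := by
        rw [this]; field_simp
      have h6 : edgeLength K.1 i * area K.1 * inner ℝ (f L - z L) (outwardNormal K.1 i) =
          edgeLength K.1 i * area K.1 * inner ℝ (f K - z K) (outwardNormal K.1 i) := by
        linarith
      exact mul_left_cancel₀ (by positivity) h6
  · have := key K i
    rw [h0, hr0, Finset.sum_empty, mul_zero, zero_add] at this
    exact (mul_eq_zero.1 this).resolve_left (edgeLength_pos K.1 i).ne'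

/-! ### Bounds on the velocity -/

/-- The energy estimate for the Darcy velocity `y = f - κ ∇_h p`: as `y` and `∇_h p` are orthogonal,
the weighted norm of `y` with weight `1 / κ` is at most that of `f`. -/
lemma sum_area_norm_sq_le {f : M.P0Vec} {κ : M.P0} {p : M.P1d} {κ₀ κ₁ : ℝ} (hκ₀ : 0 < κ₀)
    (hκ : ∀ K, κ₀ ≤ κ K ∧ κ K ≤ κ₁) (hp : IsP1nc p)
    (hy : IsConstRT0 fun K => f K - κ K • gradh p K) (hκ₁ : 0 < κ₁) :
    ∑ K, area K.1 * ‖f K - κ K • gradh p K‖ ^ 2 ≤ κ₁ / κ₀ * ∑ K, area K.1 * ‖f K‖ ^ 2 := by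
  have h0 := hy.sum_area_inner_gradh hp
  set y : M.P0Vec := fun K => f K - κ K • gradh p K with hyd
  have hκp : ∀ K, 0 < κ K := fun K => hκ₀.trans_le (hκ K).1
  have h1 : ∑ K, area K.1 / κ K * ‖y K‖ ^ 2 ≤ ∑ K, area K.1 / κ K * ‖f K‖ ^ 2 := by
    have : ∀ K ∈ Finset.univ, area K.1 / κ K * ‖y K‖ ^ 2 +
        2 * (area K.1 * inner ℝ (y K) (gradh p K)) ≤ area K.1 / κ K * ‖f K‖ ^ 2 := by
      intro K _
      have e : f K = y K + κ K • gradh p K := by simp [hyd]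
      have hk := hκp K
      rw [e, norm_add_sq_real, inner_smul_right, norm_smul, Real.norm_eq_abs, abs_of_pos hk]
      have : area K.1 / κ K * (‖y K‖ ^ 2 + 2 * (κ K * inner ℝ (y K) (gradh p K)) +
          (κ K * ‖gradh p K‖) ^ 2) = area K.1 / κ K * ‖y K‖ ^ 2 +
            2 * (area K.1 * inner ℝ (y K) (gradh p K)) +
            area K.1 * κ K * ‖gradh p K‖ ^ 2 := by field_simp
      rw [this]
      have := area_pos K.1
      have : 0 ≤ area K.1 * κ K * ‖gradh p K‖ ^ 2 := by positivity
      linarith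
    have h2 := Finset.sum_le_sum this
    rw [Finset.sum_add_distrib, ← Finset.mul_sum, h0] at h2
    linarith
  have h2 : (1 / κ₁) * ∑ K, area K.1 * ‖y K‖ ^ 2 ≤ ∑ K, area K.1 / κ K * ‖y K‖ ^ 2 := by
    rw [Finset.mul_sum]
    refine Finset.sum_le_sum fun K _ => ?_
    rw [← mul_assoc, one_div_mul_eq_div]
    have := (area_pos K.1).le
    have := hκp K
    have := (hκ K).2
    gcongr
  have h3 : ∑ K, area K.1 / κ K * ‖f K‖ ^ 2 ≤ (1 / κ₀) * ∑ K, area K.1 * ‖f K‖ ^ 2 := by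
    rw [Finset.mul_sum]
    refine Finset.sum_le_sum fun K _ => ?_
    rw [← mul_assoc, one_div_mul_eq_div]
    have := (area_pos K.1).le
    have := (hκ K).1
    gcongr
  have h4 := (h2.trans h1).trans h3
  rw [one_div_mul_eq_div, div_le_iff₀ hκ₁] at h4
  calc _ ≤ _ := h4
    _ = _ := by field_simp

lemma two_mul_circumradius_le_size (K : M.Cell) : 2 * K.1.circumradius ≤ M.size :=
  le_ciSup (f := fun K : M.Cell => 2 * K.1.circumradius) (Finite.bddAbove_range _) K

lemma size_pos (K : M.Cell) : 0 < M.size :=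
  (edgeLength_pos K.1 0).trans_le ((edgeLength_le K.1 0).trans (two_mul_circumradius_le_size K))

/-- On a regular mesh the area of a triangle is comparable to `h²`. -/
lemma Regular.area_ge {ρ : ℝ} (hρ : 0 < ρ) (hM : M.Regular ρ) (K : M.Cell) :
    ρ ^ 3 * M.size ^ 2 ≤ 2 * area K.1 := by
  have hh := size_pos K
  have h1 := edgeLength_prod_sq K.1
  have h2 : (ρ * M.size) ^ 3 ≤ edgeLength K.1 0 * edgeLength K.1 1 * edgeLength K.1 2 := by
    have e := fun i => (hM K i).2.2
    have : 0 ≤ ρ * M.size := by positivity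
    calc (ρ * M.size) ^ 3 = ρ * M.size * (ρ * M.size) * (ρ * M.size) := by ring
      _ ≤ _ := by
        have l0 := (edgeLength_pos K.1 0).le
        have l1 := (edgeLength_pos K.1 1).le
        have e0 := e 0
        have e1 := e 1
        have e2 := e 2
        gcongr
  have hR : 0 ≤ 2 * K.1.circumradius := by have := K.1.circumradius_nonneg; positivity
  have h3 : edgeLength K.1 0 * edgeLength K.1 1 * edgeLength K.1 2 =
      2 * K.1.circumradius * |det K.1| := by
    rw [← sq_abs (det K.1), ← mul_pow] at h1
    refine (sq_eq_sq₀ ?_ (by positivity)).1 h1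
    have := fun i => (edgeLength_pos K.1 i).le
    exact mul_nonneg (mul_nonneg (this 0) (this 1)) (this 2)
  have h4 : 2 * K.1.circumradius * |det K.1| ≤ M.size * |det K.1| :=
    mul_le_mul_of_nonneg_right (two_mul_circumradius_le_size K) (abs_nonneg _)
  have h5 : M.size * (ρ ^ 3 * M.size ^ 2) ≤ M.size * |det K.1| := by
    calc _ = (ρ * M.size) ^ 3 := by ring
      _ ≤ _ := h2
      _ ≤ _ := h3.le.trans h4
  rw [area_eq]
  linarith [le_of_mul_le_mul_left h5 hh]

lemma dist_circumcenter_le {K L : M.Cell} {i : Fin 3} (hL : L ∈ M.nbrs K i) :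
    dist K.1.circumcenter L.1.circumcenter ≤ M.size := by
  obtain ⟨hLK, j, hj⟩ := mem_nbrs.1 hL
  have hv : ∃ l, L.1.points l = K.1.points (i + 1) := by
    rcases endpoints_eq_of_segment_eq hj with ⟨h1, _⟩ | ⟨_, h2⟩
    · exact ⟨_, h1⟩
    · exact ⟨_, h2⟩
  obtain ⟨l, hl⟩ := hv
  have h1 := dist_triangle_left K.1.circumcenter L.1.circumcenter (K.1.points (i + 1))
  rw [K.1.dist_circumcenter_eq_circumradius, ← hl, L.1.dist_circumcenter_eq_circumradius] at h1
  linarith [two_mul_circumradius_le_size K, two_mul_circumradius_le_size L]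

lemma Regular.dist_pos {ρ : ℝ} (hρ : 0 < ρ) (hM : M.Regular ρ) (K : M.Cell) (i : Fin 3) (L : M.Cell)
    (hL : L ∈ M.nbrs K i) : 0 < dist K.1.circumcenter L.1.circumcenter :=
  (mul_pos hρ (edgeLength_pos K.1 i)).trans_le ((hM K i).1 L hL)

/-- On a regular mesh the fluxes are controlled by the `L²` norm of the velocity. -/
lemma Regular.sqFlux_le {ρ : ℝ} (hρ : 0 < ρ) (hM : M.Regular ρ) {y : M.P0Vec} {u : M.P1dVec}
    (hu : ∀ K i, normalFlux u K i = inner ℝ (y K) (outwardNormal K.1 i)) :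
    sqFlux u ≤ 3 / ρ ^ 3 * ∑ K, area K.1 * ‖y K‖ ^ 2 := by
  rw [sqFlux, Finset.mul_sum, Finset.mul_sum]
  refine Finset.sum_le_sum fun K _ => ?_
  have h1 : ∀ i ∈ Finset.univ, ∑ L ∈ M.nbrs K i, edgeLength K.1 i *
      dist K.1.circumcenter L.1.circumcenter * normalFlux u K i ^ 2 ≤ M.size ^ 2 * ‖y K‖ ^ 2 := by
    intro i _
    have hn : normalFlux u K i ^ 2 ≤ ‖y K‖ ^ 2 := by
      rw [hu, ← sq_abs]
      refine pow_le_pow_left₀ (abs_nonneg _) ((abs_real_inner_le_norm _ _).trans ?_) 2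
      rw [norm_outwardNormal, mul_one]
    rcases nbrs_eq_empty_or_singleton K i with h | ⟨L, h⟩
    · rw [h, Finset.sum_empty]; positivity
    · have hL : L ∈ M.nbrs K i := by rw [h]; simp
      rw [h, Finset.sum_singleton, sq M.size]
      have h1 := dist_circumcenter_le hL
      have h2 := (edgeLength_le K.1 i).trans (two_mul_circumradius_le_size K)
      have h3 := (edgeLength_pos K.1 i).le
      have h4 := (size_pos K).le
      gcongr
  have h2 := Finset.sum_le_sum h1
  rw [Finset.sum_const, Finset.card_univ, Fintype.card_fin, nsmul_eq_mul] at h2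
  have h3 := mul_le_mul_of_nonneg_right (hM.area_ge hρ K) (sq_nonneg ‖y K‖)
  rw [div_mul_eq_mul_div (3 : ℝ), le_div_iff₀ (by positivity)]
  push_cast at h2
  have h4 := mul_le_mul_of_nonneg_right h2 (by positivity : 0 ≤ ρ ^ 3)
  nlinarith

/-! ### Averages over the cells -/

lemma iUnion_closedInterior (M : TriMesh Ω) : ⋃ K : M.Cell, K.1.closedInterior = closure Ω := by
  rw [← M.cover, iUnion_subtype]

lemma closedInterior_subset (K : M.Cell) : K.1.closedInterior ⊆ closure Ω :=
  M.iUnion_closedInterior ▸ subset_iUnion (fun K : M.Cell => K.1.closedInterior) K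

/-- The boundary of a meshed domain is negligible, being covered by the edges. -/
lemma closure_ae_eq (M : TriMesh Ω) (hΩ : interior (closure Ω) = Ω) :
    closure Ω =ᵐ[volume] Ω := by
  refine Filter.EventuallyLE.antisymm ?_ subset_closure.eventuallyLE
  rw [ae_le_set]
  -- a point inside a triangle is interior to `closure Ω`, hence lies in `Ω`
  have hsub : closure Ω \ Ω ⊆ ⋃ K : M.Cell, frontier K.1.closedInterior := by
    rintro x ⟨hx, hxΩ⟩
    rw [← M.iUnion_closedInterior, mem_iUnion] at hx
    obtain ⟨K, hK⟩ := hx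
    refine mem_iUnion.2 ⟨K, subset_closure hK, fun h => hxΩ ?_⟩
    rw [← hΩ]
    exact interior_mono (closedInterior_subset K) h
  refine measure_mono_null hsub (measure_iUnion_null fun K => ?_)
  rw [← K.1.convexHull_eq_closedInterior]
  exact (convex_convexHull _ _).addHaar_frontier _

lemma restrict_closure (M : TriMesh Ω) (hΩ : interior (closure Ω) = Ω) :
    volume.restrict (closure Ω) = (volume.restrict Ω : Measure Plane) :=
  Measure.restrict_congr_set (M.closure_ae_eq hΩ)

lemma restrict_closedInterior_le (hΩ : interior (closure Ω) = Ω) (K : M.Cell) :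
    volume.restrict K.1.closedInterior ≤ (volume.restrict Ω : Measure Plane) :=
  M.restrict_closure hΩ ▸ Measure.restrict_mono_set _ (closedInterior_subset K)

lemma sum_setIntegral (hΩ : interior (closure Ω) = Ω) {g : Plane → ℝ}
    (hg : IntegrableOn g Ω) : ∑ K : M.Cell, ∫ x in K.1.closedInterior, g x = ∫ x in Ω, g x := by
  have hg' : IntegrableOn g (⋃ K : M.Cell, K.1.closedInterior) := by
    rwa [M.iUnion_closedInterior, IntegrableOn, M.restrict_closure hΩ]
  have h := integral_iUnion_ae
    (fun K : M.Cell => (measurableSet_closedInterior K.1).nullMeasurableSet)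
    (fun K L hKL => aedisjoint_closedInterior hKL) hg'
  rw [tsum_fintype, M.iUnion_closedInterior, M.restrict_closure hΩ] at h
  exact h.symm

lemma sum_area (hΩ : interior (closure Ω) = Ω) (hb : Bornology.IsBounded Ω) :
    ∑ K : M.Cell, area K.1 = volume.real Ω := by
  have h := sum_setIntegral (M := M) hΩ (g := fun _ => 1)
    (integrableOn_const hb.measure_lt_top.ne)
  simpa [area] using h

lemma volume_closedInterior_ne_zero (K : Affine.Triangle ℝ Plane) : volume K.closedInterior ≠ 0 := by
  intro h
  have := area_pos K
  rw [area, Measure.real, h] at this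
  simp at this

lemma memLp_closedInterior {F : Type*} [NormedAddCommGroup F] (hΩ : interior (closure Ω) = Ω)
    {g : Plane → F} (hg : MemLp g 2 (volume.restrict Ω)) (K : M.Cell) :
    MemLp g 2 (volume.restrict K.1.closedInterior) :=
  hg.mono_measure (restrict_closedInterior_le hΩ K)

lemma integrableOn_closedInterior {F : Type*} [NormedAddCommGroup F]
    (hΩ : interior (closure Ω) = Ω) {g : Plane → F} (hg : MemLp g 2 (volume.restrict Ω))
    (K : M.Cell) : IntegrableOn g K.1.closedInterior := by
  have : IsFiniteMeasure (volume.restrict K.1.closedInterior) :=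
    ⟨by simpa using measure_closedInterior_lt_top K.1⟩
  exact (memLp_closedInterior hΩ hg K).integrable one_le_two

lemma proj0_mem {F : Type*} [NormedAddCommGroup F] [NormedSpace ℝ F] [CompleteSpace F]
    (hΩ : interior (closure Ω) = Ω) {g : Plane → F} (hg : MemLp g 2 (volume.restrict Ω))
    {s : Set F} (hs : Convex ℝ s) (hsc : IsClosed s) (K : M.Cell)
    (h : ∀ᵐ x ∂volume.restrict K.1.closedInterior, g x ∈ s) : M.proj0 g K ∈ s :=
  hs.set_average_mem hsc (volume_closedInterior_ne_zero K.1) (measure_closedInterior_lt_top K.1).ne h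
    (integrableOn_closedInterior hΩ hg K)

/-- The projection on piecewise constant fields is a contraction of `L²`. -/
lemma sum_area_proj0_sq_le (hΩ : interior (closure Ω) = Ω) {f : Plane → Plane}
    (hf : MemLp f 2 (volume.restrict Ω)) :
    ∑ K : M.Cell, area K.1 * ‖M.proj0 f K‖ ^ 2 ≤ (eLpNorm f 2 (volume.restrict Ω)).toReal ^ 2 := by
  have hsq : Integrable (fun x => ‖f x‖ ^ 2) (volume.restrict Ω) :=
    (memLp_two_iff_integrable_sq_norm hf.1).1 hf
  have h1 : (eLpNorm f 2 (volume.restrict Ω)).toReal ^ 2 = ∫ x in Ω, ‖f x‖ ^ 2 := by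
    have h0 : 0 ≤ ∫ x in Ω, ‖f x‖ ^ 2 := integral_nonneg fun x => sq_nonneg _
    rw [hf.eLpNorm_eq_integral_rpow_norm two_ne_zero ENNReal.ofNat_ne_top]
    simp only [ENNReal.toReal_ofNat, Real.rpow_ofNat]
    rw [ENNReal.toReal_ofReal (by positivity), ← Real.rpow_natCast, ← Real.rpow_mul h0]
    simp
  rw [h1, ← sum_setIntegral (M := M) hΩ hsq]
  refine Finset.sum_le_sum fun K _ => ?_
  have hK : IntegrableOn (fun x => ‖f x‖ ^ 2) K.1.closedInterior :=
    (memLp_two_iff_integrable_sq_norm (memLp_closedInterior hΩ hf K).1).1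
      (memLp_closedInterior hΩ hf K)
  have hconv : ConvexOn ℝ univ fun v : Plane => ‖v‖ ^ 2 :=
    (convexOn_norm convex_univ).pow (fun v _ => norm_nonneg v) 2
  have h2 := hconv.map_set_average_le (by fun_prop) isClosed_univ
    (volume_closedInterior_ne_zero K.1) (measure_closedInterior_lt_top K.1).ne
    (Filter.Eventually.of_forall fun x => mem_univ (f x)) (integrableOn_closedInterior hΩ hf K) hK
  rw [setAverage_eq (μ := volume) (fun x => ‖f x‖ ^ 2), smul_eq_mul] at h2
  have h3 := mul_le_mul_of_nonneg_left h2 (area_pos K.1).le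
  have hA : volume.real K.1.closedInterior ≠ 0 := (area_pos K.1).ne'
  rwa [← mul_assoc, area, mul_inv_cancel₀ hA, one_mul] at h3

/-! ### The norm of the Fourier transform -/

lemma toFun_of_mem (q : M.P0) {K : M.Cell} {x : Plane} (hx : x ∈ K.1.interior) :
    P0.toFun q x = q K := by
  rw [P0.toFun, Finset.sum_eq_single K, indicator_of_mem hx]
  · intro L _ hLK
    exact indicator_of_notMem (fun h => disjoint_left.1 (disjoint_interior hLK) h hx) _
  · simp

lemma toFun_of_notMem (q : M.P0) {x : Plane} (hx : ∀ K : M.Cell, x ∉ K.1.interior) :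
    P0.toFun q x = 0 :=
  Finset.sum_eq_zero fun K _ => indicator_of_notMem (hx K) _

lemma timeFourier_of_mem (T : ℝ) (N : ℕ) (w : ℕ → M.P0) (τ : ℝ) {K : M.Cell} {x : Plane}
    (hx : x ∈ K.1.interior) : timeFourier (stepInTime T N w) τ x = stepFourier T N w τ K := by
  have : (fun t => ((P0.toFun (stepInTime T N w t) x : ℝ) : ℂ)) =
      stepFun T N fun n => (w n K : ℂ) := by
    ext t
    rw [toFun_of_mem _ hx]
    by_cases ht : t ∈ Ioo 0 T <;> simp [stepInTime, stepFun, ht]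
  rw [timeFourier, this, stepFourier]

lemma timeFourier_of_notMem (T : ℝ) (N : ℕ) (w : ℕ → M.P0) (τ : ℝ) {x : Plane}
    (hx : ∀ K : M.Cell, x ∉ K.1.interior) : timeFourier (stepInTime T N w) τ x = 0 := by
  rw [timeFourier, Real.fourier_eq']
  simp [toFun_of_notMem _ hx]

lemma eLpNorm_timeFourier_sq_le (T : ℝ) (N : ℕ) (w : ℕ → M.P0) (τ : ℝ) :
    eLpNorm (timeFourier (stepInTime T N w) τ) 2 (volume.restrict Ω) ^ 2 ≤
      ENNReal.ofReal (sqL2 (stepFourier T N w τ)) := by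
  have h1 : eLpNorm (timeFourier (stepInTime T N w) τ) 2 (volume.restrict Ω) ^ 2 =
      ∫⁻ x in Ω, ‖timeFourier (stepInTime T N w) τ x‖ₑ ^ 2 := by
    rw [eLpNorm_eq_lintegral_rpow_enorm_toReal two_ne_zero ENNReal.ofNat_ne_top,
      ← ENNReal.rpow_natCast, ← ENNReal.rpow_mul]
    simp
  have h2 : ∀ x, ‖timeFourier (stepInTime T N w) τ x‖ₑ ^ 2 ≤
      ∑ K : M.Cell, K.1.interior.indicator (fun _ => ‖stepFourier T N w τ K‖ₑ ^ 2) x := by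
    intro x
    by_cases hx : ∃ K : M.Cell, x ∈ K.1.interior
    · obtain ⟨K, hK⟩ := hx
      rw [timeFourier_of_mem T N w τ hK]
      refine le_trans (le_of_eq ?_) (Finset.single_le_sum
        (f := fun K : M.Cell => K.1.interior.indicator (fun _ => ‖stepFourier T N w τ K‖ₑ ^ 2) x)
        (fun _ _ => zero_le) (Finset.mem_univ K))
      rw [indicator_of_mem hK]
    · push Not at hx
      rw [timeFourier_of_notMem T N w τ hx]
      simp
  rw [h1]
  calc ∫⁻ x in Ω, ‖timeFourier (stepInTime T N w) τ x‖ₑ ^ 2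
      ≤ ∫⁻ x, ‖timeFourier (stepInTime T N w) τ x‖ₑ ^ 2 := setLIntegral_le_lintegral _ _
    _ ≤ ∫⁻ x, ∑ K : M.Cell, K.1.interior.indicator (fun _ => ‖stepFourier T N w τ K‖ₑ ^ 2) x :=
      lintegral_mono h2
    _ = ∑ K : M.Cell, ‖stepFourier T N w τ K‖ₑ ^ 2 * volume K.1.interior := by
      rw [lintegral_finsetSum _ fun K _ =>
        measurable_const.indicator (isOpen_interior K.1).measurableSet]
      exact Finset.sum_congr rfl fun K _ =>
        lintegral_indicator_const (isOpen_interior K.1).measurableSet _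
    _ ≤ ∑ K : M.Cell, ENNReal.ofReal (area K.1 * ‖stepFourier T N w τ K‖ ^ 2) := by
      refine Finset.sum_le_sum fun K _ => ?_
      rw [ENNReal.ofReal_mul (area_pos K.1).le, ENNReal.ofReal_pow (norm_nonneg _), ofReal_norm,
        mul_comm, area, Measure.real, ENNReal.ofReal_toReal (measure_closedInterior_lt_top K.1).ne]
      gcongr
      exact K.1.interior_subset_closedInterior
    _ = _ := by
      rw [sqL2, ENNReal.ofReal_sum_of_nonneg fun K _ =>
        mul_nonneg (area_pos K.1).le (sq_nonneg _)]

end TriMesh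

/-! ### Discrete solutions -/

open TriMesh

variable {d : TransportData} {M : TriMesh d.Ω}

lemma TransportData.Admissible.s_nonneg (hd : d.Admissible) :
    ∀ᵐ x ∂volume.restrict d.Ω, 0 ≤ d.s x := by
  filter_upwards [hd.sθ_bound] with x hx
  have := hd.θlo_lt_θhi
  nlinarith [hx.1, hx.2]

/-- The bounds on `s_θ` force `s ≥ 0`, whereas the source of a solvable pressure equation has zero
mean; hence `s` vanishes on the mesh, and the flow is free of divergence. -/
lemma source_ae_eq_zero (hd : d.Admissible) {t : ℝ} {c θ : M.P0} {p : M.P1d} {u : M.P1dVec}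
    (h : IsDarcyStep d t c θ p u) (K : M.Cell) :
    ∀ᵐ x ∂volume.restrict K.1.closedInterior, d.s x = 0 := by
  have hΩ := hd.domain.interior_closure
  obtain ⟨a, b, r, ha, hb, hr, hab⟩ := h.pressure
  have h0 := sum_area_source_eq_zero ha hb hab hr
  have hs : ∀ K : M.Cell, 0 ≤ᵐ[volume.restrict K.1.closedInterior] d.s := fun K =>
    ae_mono (restrict_closedInterior_le hΩ K) hd.s_nonneg
  have hK : ∀ K : M.Cell, area K.1 * M.proj0 d.s K = ∫ x in K.1.closedInterior, d.s x := by
    intro K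
    have hA : volume.real K.1.closedInterior ≠ 0 := (area_pos K.1).ne'
    rw [proj0, setAverage_eq, smul_eq_mul, ← mul_assoc, area, mul_inv_cancel₀ hA, one_mul]
  simp only [hK] at h0
  have h1 := (Finset.sum_eq_zero_iff_of_nonneg fun K _ =>
    integral_nonneg_of_ae (hs K)).1 h0 K (Finset.mem_univ K)
  exact (setIntegral_eq_zero_iff_of_nonneg_ae (hs K)
    (integrableOn_closedInterior hΩ hd.s_mem K)).1 h1

lemma proj0_s_eq_zero (hd : d.Admissible) {t : ℝ} {c θ : M.P0} {p : M.P1d} {u : M.P1dVec}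
    (h : IsDarcyStep d t c θ p u) (K : M.Cell) : M.proj0 d.s K = 0 :=
  proj0_mem hd.domain.interior_closure hd.s_mem (convex_singleton 0) isClosed_singleton K
    (source_ae_eq_zero hd h K)

lemma proj0_sθ_eq_zero (hd : d.Admissible) {t : ℝ} {c θ : M.P0} {p : M.P1d} {u : M.P1dVec}
    (h : IsDarcyStep d t c θ p u) (K : M.Cell) : M.proj0 d.sθ K = 0 := by
  have hΩ := hd.domain.interior_closure
  refine proj0_mem hΩ hd.sθ_mem (convex_singleton 0) isClosed_singleton K ?_
  filter_upwards [source_ae_eq_zero hd h K,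
    ae_mono (restrict_closedInterior_le hΩ K) hd.sθ_bound] with x hx hb
  rw [hx, mul_zero, zero_add, mul_zero, zero_add] at hb
  exact le_antisymm hb.1 hb.2

lemma proj0_sc_mem (hd : d.Admissible) {t : ℝ} {c θ : M.P0} {p : M.P1d} {u : M.P1dVec}
    (h : IsDarcyStep d t c θ p u) (K : M.Cell) : M.proj0 d.sc K ∈ Icc 0 d.lam := by
  have hΩ := hd.domain.interior_closure
  refine proj0_mem hΩ hd.sc_mem (convex_Icc _ _) isClosed_Icc K ?_
  filter_upwards [source_ae_eq_zero hd h K,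
    ae_mono (restrict_closedInterior_le hΩ K) hd.sc_bound] with x hx hb
  rw [hx, mul_zero, zero_add] at hb
  exact hb

lemma IsDarcyStep.isConstRT0 (hd : d.Admissible) {t : ℝ} {c θ : M.P0} {p : M.P1d} {u : M.P1dVec}
    (h : IsDarcyStep d t c θ p u) :
    IsConstRT0 fun K => M.proj0 (d.f t) K - d.κ (c K) (θ K) • gradh p K := by
  obtain ⟨a, b, r, ha, hb, hr, hab⟩ := h.pressure
  exact isConstRT0_of_source_eq_zero ha hb hab hr (proj0_s_eq_zero hd h)

lemma IsDarcyStep.hasBalancedFlux (hd : d.Admissible) {t : ℝ} {c θ : M.P0} {p : M.P1d}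
    {u : M.P1dVec} (h : IsDarcyStep d t c θ p u) : HasBalancedFlux u :=
  h.velocity.hasBalancedFlux (h.isConstRT0 hd)

/-- The discrete maximum principle for the scheme. -/
lemma IsDiscreteSolution.bounds (hd : d.Admissible) {N : ℕ} (hN : 1 ≤ N) {c θ : ℕ → M.P0}
    {p : ℕ → M.P1d} {u : ℕ → M.P1dVec} (h : IsDiscreteSolution d M N c θ p u) :
    (∀ n < N, IsStep (d.T / N) d.Dc d.lam (M.proj0 d.sc) (u n) (c n) (c (n + 1))) ∧
    (∀ n < N, IsStep (d.T / N) d.Dθ 0 0 (u n) (θ n) (θ (n + 1))) ∧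
    (∀ n ≤ N, ∀ K, c n K ∈ Icc (0 : ℝ) 1) ∧ ∀ n ≤ N, ∀ K, θ n K ∈ Icc d.θlo d.θhi := by
  have hΩ := hd.domain.interior_closure
  have hN' : (0 : ℝ) < N := by exact_mod_cast hN
  have hT := hd.T_pos
  have hk : 0 < d.T / N := by positivity
  have hdarcy := h.darcy 0 (Nat.zero_le _)
  have hcs : ∀ n < N, IsStep (d.T / N) d.Dc d.lam (M.proj0 d.sc) (u n) (c n) (c (n + 1)) := by
    intro n hn K
    rw [h.c_step n hn K, proj0_s_eq_zero hd hdarcy, zero_add]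
  have hθs : ∀ n < N, IsStep (d.T / N) d.Dθ 0 0 (u n) (θ n) (θ (n + 1)) := by
    intro n hn K
    rw [h.θ_step n hn K, proj0_s_eq_zero hd hdarcy, proj0_sθ_eq_zero hd hdarcy]
    simp
  refine ⟨hcs, hθs, fun n hn => ?_, fun n hn => ?_⟩
  · induction n with
    | zero =>
      intro K
      rw [h.c_init]
      exact proj0_mem hΩ hd.c₀_mem.1 (convex_Icc _ _) isClosed_Icc K
        (ae_mono (restrict_closedInterior_le hΩ K) hd.c₀_bound)
    | succ n ih =>
      intro K
      have hu := (h.darcy n (by omega)).hasBalancedFlux hd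
      have hc := ih (by omega)
      have hsc := proj0_sc_mem hd hdarcy
      exact ⟨(hcs n hn).ge hk hd.Dc_pos.le hd.lam_pos.le hu (fun J => by simpa using (hsc J).1)
          (fun J => (hc J).1) K,
        (hcs n hn).le hk hd.Dc_pos.le hd.lam_pos.le hu (fun J => by simpa using (hsc J).2)
          (fun J => (hc J).2) K⟩
  · induction n with
    | zero =>
      intro K
      rw [h.θ_init]
      exact proj0_mem hΩ hd.θ₀_mem.1 (convex_Icc _ _) isClosed_Icc K
        (ae_mono (restrict_closedInterior_le hΩ K) hd.θ₀_bound)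
    | succ n ih =>
      intro K
      have hu := (h.darcy n (by omega)).hasBalancedFlux hd
      have hθ := ih (by omega)
      exact ⟨(hθs n hn).ge hk hd.Dθ_pos.le le_rfl hu (fun J => by simp) (fun J => (hθ J).1) K,
        (hθs n hn).le hk hd.Dθ_pos.le le_rfl hu (fun J => by simp) (fun J => (hθ J).2) K⟩

/-- The fluxes of all discrete solutions on regular meshes are bounded, because `κ` is bounded on
the compact set `[0, 1] × [θ₋, θ₊]` of admissible values and `𝐟` is bounded on `[0, T]`. -/
lemma exists_sqFlux_le (hd : d.Admissible) {ρ : ℝ} (hρ : 0 < ρ) :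
    ∃ U : ℝ, 0 ≤ U ∧ ∀ M : TriMesh d.Ω, M.Regular ρ → ∀ t ∈ Icc 0 d.T, ∀ (c θ : M.P0) (p : M.P1d)
      (u : M.P1dVec), (∀ K, c K ∈ Icc (0 : ℝ) 1) → (∀ K, θ K ∈ Icc d.θlo d.θhi) →
        IsDarcyStep d t c θ p u → sqFlux u ≤ U := by
  have hsub : Icc (0 : ℝ) 1 ×ˢ Icc d.θlo d.θhi ⊆ Icc 0 1 ×ˢ Ioi 0 :=
    prod_mono_right fun x hx => hd.θlo_pos.trans_le hx.1
  obtain ⟨κ₁, hκ₁⟩ := (isCompact_Icc.prod isCompact_Icc).exists_bound_of_continuousOn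
    (hd.κ_cont.mono hsub)
  obtain ⟨F, hF⟩ := isCompact_Icc.exists_bound_of_continuousOn hd.f_cont
  have hκ₀ := hd.κinf_pos
  have hbd : ∀ a ∈ Icc (0 : ℝ) 1, ∀ b ∈ Icc d.θlo d.θhi, d.κinf ≤ d.κ a b ∧ d.κ a b ≤ κ₁ :=
    fun a ha b hb => ⟨hd.κ_ge a ha b (hd.θlo_pos.trans_le hb.1),
      (le_abs_self _).trans (hκ₁ (a, b) ⟨ha, hb⟩)⟩
  have hκ₁0 : 0 < κ₁ := by
    have := hbd 0 (by simp) d.θlo ⟨le_rfl, hd.θlo_lt_θhi.le⟩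
    linarith
  refine ⟨3 / ρ ^ 3 * (κ₁ / d.κinf * F ^ 2), by positivity,
    fun M hM t ht c θ p u hc hθ h => ?_⟩
  have hy := h.isConstRT0 hd
  refine (hM.sqFlux_le hρ fun K i => h.velocity.normalFlux_eq hy K i).trans ?_
  refine mul_le_mul_of_nonneg_left ?_ (by positivity)
  refine (sum_area_norm_sq_le hκ₀ (fun K => hbd _ (hc K) _ (hθ K)) h.p_nc hy hκ₁0).trans ?_
  refine mul_le_mul_of_nonneg_left ?_ (by positivity)
  refine (sum_area_proj0_sq_le hd.domain.interior_closure (hd.f_mem t ht)).trans ?_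
  exact pow_le_pow_left₀ ENNReal.toReal_nonneg ((le_abs_self _).trans (hF t ht)) 2

end NuclearTransport

theorem mainTheorem8 (d : TransportData) (hd : d.Admissible) (ρ : ℝ) (hρ : 0 < ρ)
    (γ : ℝ) (hγ₀ : 0 < γ) (hγ₁ : γ < 1 / 4) :
    ∃ C : ℝ≥0, ∀ M : TriMesh d.Ω, M.Regular ρ → ∀ N : ℕ, 1 ≤ N →
      ∀ (c θ : ℕ → M.P0) (p : ℕ → M.P1d) (u : ℕ → M.P1dVec),
        IsDiscreteSolution d M N c θ p u →
          ∫⁻ τ : ℝ, ENNReal.ofReal (|τ| ^ (2 * γ)) *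
              (eLpNorm (timeFourier (stepInTime d.T N c) τ) 2 (volume.restrict d.Ω) ^ 2 +
                eLpNorm (timeFourier (stepInTime d.T N θ) τ) 2 (volume.restrict d.Ω) ^ 2) ≤ C := by
  have hΩ := hd.domain.interior_closure
  have hθhi : 0 < d.θhi := hd.θlo_pos.trans hd.θlo_lt_θhi
  obtain ⟨U, hU, hflux⟩ := exists_sqFlux_le hd hρ
  obtain ⟨C₁, hC₁⟩ := TriMesh.IsBoundedEvolution.exists_lintegral_le d.Ω hγ₀ hγ₁ (ℓ := d.lam)
    hd.T_pos hd.Dc_pos zero_le_one hd.lam_pos.le hU (measureReal_nonneg (μ := volume) (s := d.Ω))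
  obtain ⟨C₂, hC₂⟩ := TriMesh.IsBoundedEvolution.exists_lintegral_le d.Ω hγ₀ hγ₁ (ℓ := 0)
    hd.T_pos hd.Dθ_pos hθhi.le le_rfl hU (measureReal_nonneg (μ := volume) (s := d.Ω))
  refine ⟨C₁ + C₂, fun M hM N hN c θ p u h => ?_⟩
  have hN' : (0 : ℝ) < N := by exact_mod_cast hN
  obtain ⟨hcs, hθs, hc, hθ⟩ := h.bounds hd hN
  have hbal : ∀ n < N, TriMesh.HasBalancedFlux (u n) := fun n hn =>
    (h.darcy n hn.le).hasBalancedFlux hd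
  have hfl : ∀ n < N, TriMesh.sqFlux (u n) ≤ U := fun n hn => by
    refine hflux M hM (n * (d.T / N)) ⟨?_, ?_⟩ _ _ _ _ (hc n hn.le) (hθ n hn.le) (h.darcy n hn.le)
    · have := hd.T_pos; positivity
    · rw [← mul_div_assoc, div_le_iff₀ hN', mul_comm]
      exact mul_le_mul_of_nonneg_left (by exact_mod_cast hn.le) hd.T_pos.le
  have harea := (TriMesh.sum_area (M := M) hΩ hd.domain.isBounded).le
  have h1 := hC₁ M N hN _ u c ⟨hcs, hbal, hM.dist_pos hρ, fun n hn K => abs_le.2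
    ⟨by linarith [(hc n hn K).1], (hc n hn K).2⟩, fun n hn K => by
      have hs := proj0_sc_mem hd (h.darcy 0 (Nat.zero_le _)) K
      have hb := hc (n + 1) hn K
      have hl := hd.lam_pos
      refine abs_le.2 ⟨?_, ?_⟩ <;> nlinarith [hs.1, hs.2, hb.1, hb.2], hfl, harea⟩
  have h2 := hC₂ M N hN 0 u θ ⟨hθs, hbal, hM.dist_pos hρ, fun n hn K => abs_le.2
    ⟨by linarith [(hθ n hn K).1, hd.θlo_pos], (hθ n hn K).2⟩, fun n hn K => by simp, hfl, harea⟩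
  rw [ENNReal.coe_add]
  refine le_trans (lintegral_mono fun τ => ?_) ((lintegral_add_left ?_ _).trans_le
    (add_le_add h1 h2))
  · rw [← mul_add]
    gcongr
    · exact TriMesh.eLpNorm_timeFourier_sq_le d.T N c τ
    · exact TriMesh.eLpNorm_timeFourier_sq_le d.T N θ τ
  · have := TriMesh.measurable_sqL2_stepFourier hd.T_pos hN c
    fun_prop
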